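/- Let $\mathfrak g=\mathfrak{osp}(1|2)$ be the real Lie superalgebra with even basis vectors $H,X,Y$, odd basis vectors $A,B$, and graded antisymmetric bracket determined by $$[H,X]=X,\ [H,Y]=-Y,\ [X,Y]=2H,\ [H,A]=\tfrac12A,\ [H,B]=-\tfrac12B,\ [X,A]=0,\ [X,B]=-A,\ [Y,A]=-B,\ [Y,B]=0,$$ $$[A,A]=2X,\quad [A,B]=2H,\quad [B,B]=-2Y.$$ Let $M=M_0\oplus M_1$ be a complex $\mathbb Z_2$-graded vector space with a graded $\mathbb C$-linear action of $\mathfrak g$, i.e. $\mathfrak g_iM_j\subset M_{i+j}$ and $[U,V]v=U(Vv)-(-1)^{UV}V(Uv)$ for homogeneous $U,V$ (an element in an exponent of $-1$ stands for its parity). Suppose that $H$ acts diagonalizably, $M=\bigoplus_{\alpha\in\mathbb C}M^\alpha$ with $M^\alpha=\{v: Hv=\alpha v\}$, and that $A$ acts surjectively on $M$. For a subspace $V$ put $V^\alpha=V\cap M^\alpha$, and let $\ker A,\ker B\subset M$ be the kernels of the actions of $A$ and $B$. Let $C^n$ be the complex vector space of all real $n$-linear maps $f:\mathfrak g^n\to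 M$ that are graded antisymmetric: exchanging two neighbouring homogeneous arguments $U,V$ multiplies the value by $-(-1)^{UV}$. Such an $f$ has parity $p$ (also written $f$ in exponents) if $f(\mathfrak g_{i_1},\dots,\mathfrak g_{i_n})\subset M_{p+i_1+\dots+i_n}$; every $f\in C^n$ is the sum of its components of parity $0$ and $1$. Let $\partial:C^n\to C^{n+1}$ be the linear map given, for homogeneous $f$ and homogeneous $U_0,\dots,U_n$, by $$\begin{aligned}(\partial f)(U_0,\dots,U_n)=&\sum_{i=0}^n(-1)^i(-1)^{U_i(f+U_0+\cdots+U_{i-1})}\,U_i f(U_0,\dots,\widehat{U_i},\dots,U_n)\\&+\sum_{0\le i<j\le n}(-1)^{i+j}(-1)^{U_i(U_0+\cdots+U_{i-1})}(-1)^{U_j(U_0+\cdots+\widehat{U_i}+\cdots+U_{j-1})}f([U_i,U_j],U_0,\dots,\widehat{U_i},\dots,\widehat{U_j},\dots,U_n),\end{aligned}$$ and put $Z^n=\ker(\partial:C^n\to C^{n+1})$, $B^n=\partial(C^{n-1})$ (with $B^0=0$), $\mathrm H^n(\mathfrak g,M)=Z^n/B^n$. Then, as complex vector spaces: (i) $\mathrm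 H^0(\mathfrak g,M)=\ker A\cap\ker B$ (under the identification $C^0=M$); (ii) $\mathrm H^1(\mathfrak g,M)\simeq(\ker A\cap\ker B)\oplus\big((\ker A)^{-1/2}/B((\ker A)^0)\big)$; (iii) $\mathrm H^2(\mathfrak g,M)\simeq(\ker A)^{-1/2}/B((\ker A)^0)$; (iv) $\mathrm H^n(\mathfrak g,M)=0$ for all $n>2$. -/

import Mathlib

namespace Osp12

/-- The five basis vectors of `osp(1|2)`. -/
inductive Gen : Type
  | H | X | Y | A | B
  deriving DecidableEq

instance : Fintype Gen where
  elems := {.H, .X, .Y, .A, .B}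
  complete := by intro a; cases a <;> simp

/-- Parity of a basis vector: `H, X, Y` are even and `A, B` are odd. -/
def par : Gen → ZMod 2
  | .H => 0
  | .X => 0
  | .Y => 0
  | .A => 1
  | .B => 1

/-- The underlying real vector space of `osp(1|2)`, with basis `H, X, Y, A, B`. -/
abbrev Osp : Type := Gen → ℝ

/-- The basis vector of `osp(1|2)` attached to a generator. -/
def e (a : Gen) : Osp := Pi.single a 1

/-- The brackets of basis vectors. -/
noncomputable def brTable : Gen → Gen → Osp
  | .H, .H => 0
  | .H, .X => e .X
  | .H, .Y => -e .Y
  | .H, .A => (1 / 2 : ℝ) • e .A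
  | .H, .B => -((1 / 2 : ℝ) • e .B)
  | .X, .H => -e .X
  | .X, .X => 0
  | .X, .Y => (2 : ℝ) • e .H
  | .X, .A => 0
  | .X, .B => -e .A
  | .Y, .H => e .Y
  | .Y, .X => -((2 : ℝ) • e .H)
  | .Y, .Y => 0
  | .Y, .A => -e .B
  | .Y, .B => 0
  | .A, .H => -((1 / 2 : ℝ) • e .A)
  | .A, .X => 0
  | .A, .Y => e .B
  | .A, .A => (2 : ℝ) • e .X
  | .A, .B => (2 : ℝ) • e .H
  | .B, .H => (1 / 2 : ℝ) • e .B
  | .B, .X => e .A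
  | .B, .Y => 0
  | .B, .A => (2 : ℝ) • e .H
  | .B, .B => -((2 : ℝ) • e .Y)

/-- The (graded antisymmetric) bilinear bracket of `osp(1|2)`. -/
noncomputable def br (U V : Osp) : Osp := ∑ a, ∑ b, (U a * V b) • brTable a b

/-- `U` is homogeneous of parity `i`, i.e. `U` lies in `osp(1|2)_i`. -/
def IsHomog (i : ZMod 2) (U : Osp) : Prop := ∀ a, U a ≠ 0 → par a = i

/-- The sign `(-1)^i` for a parity `i`. -/
def sgn (i : ZMod 2) : ℤ := (-1) ^ i.val

/-- A structure of `ℤ/2`-graded `osp(1|2)`-module on a complex vector space `M`. -/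
structure OspModule (M : Type*) [AddCommGroup M] [Module ℂ M] where
  /-- the homogeneous components `M₀` and `M₁` -/
  gr : ZMod 2 → Submodule ℂ M
  /-- `M = M₀ ⊕ M₁` -/
  isCompl : IsCompl (gr 0) (gr 1)
  /-- the action of `osp(1|2)` -/
  ρ : Osp →ₗ[ℝ] Module.End ℂ M
  ρ_mem : ∀ (i j : ZMod 2) (U : Osp) (v : M), IsHomog i U → v ∈ gr j → ρ U v ∈ gr (i + j)
  ρ_br : ∀ (i j : ZMod 2) (U V : Osp), IsHomog i U → IsHomog j V → ∀ v : M,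
    ρ (br U V) v = ρ U (ρ V v) - sgn (i * j) • ρ V (ρ U v)

/-- All real `n`-linear maps from `osp(1|2)` to `M`. -/
abbrev Multi (M : Type*) [AddCommGroup M] [Module ℂ M] (n : ℕ) : Type _ :=
  MultilinearMap ℝ (fun _ : Fin n => Osp) M

section

variable {M : Type*} [AddCommGroup M] [Module ℂ M]

/-- The multilinear map with prescribed values on tuples of basis vectors. -/
noncomputable def ofBasis {n : ℕ} (F : (Fin n → Gen) → M) : Multi M n :=
  ∑ u : Fin n → Gen,
    ((MultilinearMap.mkPiAlgebra ℝ (Fin n) ℝ).compLinearMap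
      (fun k => LinearMap.proj (R := ℝ) (φ := fun _ : Gen => ℝ) (u k))).smulRight (F u)

theorem ofBasis_apply {n : ℕ} (F : (Fin n → Gen) → M) (U : Fin n → Osp) :
    ofBasis F U = ∑ u : Fin n → Gen, (∏ k, U k (u k)) • F u := by
  simp [ofBasis]

/-- `ofBasis F` takes the value `F u` on the tuple of basis vectors indexed by `u`. -/
theorem ofBasis_basis {n : ℕ} (F : (Fin n → Gen) → M) (u : Fin n → Gen) :
    ofBasis F (fun k => e (u k)) = F u := by
  rw [ofBasis_apply, Finset.sum_eq_single u]
  · simp [e]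
  · intro w _ hw
    obtain ⟨k, hk⟩ := Function.ne_iff.mp hw
    rw [Finset.prod_eq_zero (Finset.mem_univ k), zero_smul]
    simp [e, hk]
  · simp

theorem ofBasis_add {n : ℕ} (F G : (Fin n → Gen) → M) :
    ofBasis (fun u => F u + G u) = ofBasis F + ofBasis G := by
  ext U
  simp [ofBasis_apply, Finset.sum_add_distrib]

theorem ofBasis_smul {n : ℕ} (c : ℂ) (F : (Fin n → Gen) → M) :
    ofBasis (fun u => c • F u) = c • ofBasis F := by
  ext U
  simp [ofBasis_apply, Finset.smul_sum, smul_comm c]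

/-- The space `Cⁿ` of `n`-cochains: the `n`-linear maps that are graded antisymmetric, i.e. exchanging
two neighbouring homogeneous arguments `U`, `V` multiplies the value by `-(-1)^{UV}`. -/
def cochains (M : Type*) [AddCommGroup M] [Module ℂ M] (n : ℕ) : Submodule ℂ (Multi M n) where
  carrier := {f | ∀ (q : Fin n → ZMod 2) (U : Fin n → Osp), (∀ k, IsHomog (q k) (U k)) →
    ∀ i j : Fin n, (i : ℕ) + 1 = j →
      f (fun k => U (Equiv.swap i j k)) = -(sgn (q i * q j) • f U)}
  add_mem' := by
    intro f g hf hg q U hU i j hij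
    simp only [add_apply, hf q U hU i j hij, hg q U hU i j hij, smul_add]
    abel
  zero_mem' := by
    intro q U _ i j _
    simp
  smul_mem' := by
    intro c f hf q U hU i j hij
    simp only [smul_apply, hf q U hU i j hij, smul_neg]
    rw [smul_comm]

namespace OspModule

variable (V : OspModule M)

theorem isCompl' (i : ZMod 2) : IsCompl (V.gr i) (V.gr (i + 1)) := by
  fin_cases i
  · exact V.isCompl
  · exact V.isCompl.symm

/-- The projection of `M` onto its component `M_i`. -/
noncomputable def proj (i : ZMod 2) : M →ₗ[ℂ] M := (V.gr i).projection (V.gr (i + 1)) (V.isCompl' i)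

/-- The component of parity `p` of an `n`-linear map `f = f₀ + f₁`; a homogeneous map of parity `p`
sends homogeneous arguments of parities `q₁, …, qₙ` to `M_{p + q₁ + ⋯ + qₙ}`. -/
noncomputable def component {n : ℕ} (p : ZMod 2) (f : Multi M n) : Multi M n :=
  ofBasis (fun u => V.proj (p + ∑ k, par (u k)) (f (fun k => e (u k))))

/-- The first sum of the coboundary formula, for `f` of parity `p` and arguments `U₀, …, Uₙ` of
parities `q₀, …, qₙ`. -/
noncomputable def actionSum {n : ℕ} (p : ZMod 2) (f : Multi M n) (q : Fin (n + 1) → ZMod 2)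
    (U : Fin (n + 1) → Osp) : M :=
  ∑ i : Fin (n + 1), ((-1) ^ (i : ℕ) * sgn (q i * (p + ∑ k with k < i, q k))) •
    V.ρ (U i) (f (fun k => U (i.succAbove k)))

end OspModule

/-- The second sum of the coboundary formula, over `0 ≤ i < j ≤ n`, for arguments `U₀, …, Uₙ` of
parities `q₀, …, qₙ`. Here `i < j ≤ n` is encoded by `i : Fin n`, `j : Fin (n + 1)` with
`i.castSucc < j`, and `k ↦ j.succAbove (i.succAbove k)` enumerates the indices other than `i`, `j`
in increasing order. -/
noncomputable def bracketSum : {n : ℕ} → (f : Multi M n) → (q : Fin (n + 1) → ZMod 2) →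
    (U : Fin (n + 1) → Osp) → M
  | 0, _, _, _ => 0
  | n + 1, f, q, U =>
    ∑ i : Fin (n + 1), ∑ j : Fin (n + 2) with i.castSucc < j,
      ((-1) ^ ((i : ℕ) + (j : ℕ)) * sgn (q i.castSucc * ∑ k with k < i.castSucc, q k) *
        sgn (q j * ∑ k with k < j ∧ k ≠ i.castSucc, q k)) •
      f (Fin.cons (br (U i.castSucc) (U j)) (fun k : Fin n => U (j.succAbove (i.succAbove k))))

namespace OspModule

variable (V : OspModule M)

/-- The value of `∂f` on the basis vectors indexed by `u`: the coboundary formula applied to the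
components of `f` of parity `0` and `1`. -/
noncomputable def dBasis {n : ℕ} (f : Multi M n) (u : Fin (n + 1) → Gen) : M :=
  ∑ p : ZMod 2,
    (V.actionSum p (V.component p f) (fun k => par (u k)) (fun k => e (u k)) +
      bracketSum (V.component p f) (fun k => par (u k)) (fun k => e (u k)))

theorem component_add {n : ℕ} (p : ZMod 2) (f g : Multi M n) :
    V.component p (f + g) = V.component p f + V.component p g := by
  simp only [component, add_apply, map_add, ofBasis_add]

theorem component_smul {n : ℕ} (p : ZMod 2) (c : ℂ) (f : Multi M n) :
    V.component p (c • f) = c • V.component p f := by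
  simp only [component, smul_apply, map_smul, ofBasis_smul]

theorem actionSum_add {n : ℕ} (p : ZMod 2) (f g : Multi M n) (q : Fin (n + 1) → ZMod 2)
    (U : Fin (n + 1) → Osp) :
    V.actionSum p (f + g) q U = V.actionSum p f q U + V.actionSum p g q U := by
  simp only [actionSum, add_apply, map_add, smul_add, Finset.sum_add_distrib]

theorem actionSum_smul {n : ℕ} (p : ZMod 2) (c : ℂ) (f : Multi M n) (q : Fin (n + 1) → ZMod 2)
    (U : Fin (n + 1) → Osp) :
    V.actionSum p (c • f) q U = c • V.actionSum p f q U := by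
  simp only [actionSum, smul_apply, map_smul, Finset.smul_sum]
  exact Finset.sum_congr rfl fun i _ => smul_comm _ _ _

end OspModule

theorem bracketSum_add {n : ℕ} (f g : Multi M n) (q : Fin (n + 1) → ZMod 2)
    (U : Fin (n + 1) → Osp) :
    bracketSum (f + g) q U = bracketSum f q U + bracketSum g q U := by
  cases n with
  | zero => simp [bracketSum]
  | succ n =>
    simp only [bracketSum, add_apply, smul_add, Finset.sum_add_distrib]

theorem bracketSum_smul {n : ℕ} (c : ℂ) (f : Multi M n) (q : Fin (n + 1) → ZMod 2)
    (U : Fin (n + 1) → Osp) :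
    bracketSum (c • f) q U = c • bracketSum f q U := by
  cases n with
  | zero => simp [bracketSum]
  | succ n =>
    simp only [bracketSum, smul_apply, Finset.smul_sum]
    exact Finset.sum_congr rfl fun i _ => Finset.sum_congr rfl fun j _ => smul_comm _ _ _

namespace OspModule

variable (V : OspModule M)

/-- The coboundary operator `∂`, as a linear map on all multilinear maps. -/
noncomputable def d (n : ℕ) : Multi M n →ₗ[ℂ] Multi M (n + 1) where
  toFun f := ofBasis (V.dBasis f)
  map_add' f g := by
    rw [← ofBasis_add]
    congr 1
    funext u
    simp only [dBasis, component_add, actionSum_add, bracketSum_add, ← Finset.sum_add_distrib]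
    exact Finset.sum_congr rfl fun p _ => by abel
  map_smul' c f := by
    rw [RingHom.id_apply, ← ofBasis_smul]
    congr 1
    funext u
    simp only [dBasis, component_smul, actionSum_smul, bracketSum_smul, Finset.smul_sum, smul_add]

/-- The `n`-cocycles `Zⁿ = ker (∂ : Cⁿ → Cⁿ⁺¹)`. -/
noncomputable def cocycles (n : ℕ) : Submodule ℂ (Multi M n) :=
  cochains M n ⊓ LinearMap.ker (V.d n)

/-- The `n`-coboundaries `Bⁿ = ∂(Cⁿ⁻¹)`, with `B⁰ = 0`. -/
noncomputable def coboundaries : (n : ℕ) → Submodule ℂ (Multi M n)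
  | 0 => ⊥
  | n + 1 => (cochains M n).map (V.d n)

/-- The cohomology space `Hⁿ(osp(1|2), M) = Zⁿ / Bⁿ`. As `∂` maps cochains to cochains and
`∂ ∘ ∂ = 0` on cochains, `Bⁿ ⊆ Zⁿ`; `submoduleOf` only regards `Bⁿ` as a subspace of `Zⁿ`. -/
abbrev Cohomology (n : ℕ) : Type _ :=
  V.cocycles n ⧸ (V.coboundaries n).submoduleOf (V.cocycles n)

/-- The class in `Hⁿ(osp(1|2), M)` of a cocycle. -/
noncomputable abbrev cohomologyClass (n : ℕ) (z : V.cocycles n) : V.Cohomology n :=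
  Submodule.Quotient.mk z

/-- `M` is a weight module: `H` acts diagonalizably, i.e. `M` is the (automatically direct) sum of
the weight spaces `M^α = {v | H v = α v}`, `α ∈ ℂ`. -/
def IsWeight : Prop := ⨆ α : ℂ, Module.End.eigenspace (V.ρ (e .H)) α = ⊤

/-- `ker A`. -/
noncomputable def kerA : Submodule ℂ M := LinearMap.ker (V.ρ (e .A))

/-- `ker B`. -/
noncomputable def kerB : Submodule ℂ M := LinearMap.ker (V.ρ (e .B))

/-- `(ker A)^α = ker A ∩ M^α`. -/
noncomputable def kerAWeight (α : ℂ) : Submodule ℂ M :=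
  V.kerA ⊓ Module.End.eigenspace (V.ρ (e .H)) α

/-- The quotient `(ker A)^{-1/2} / B((ker A)^0)`; note that `B((ker A)^0) ⊆ (ker A)^{-1/2}`, since
`AB + BA = 2H` on `M`. -/
abbrev KerQuotient : Type _ :=
  V.kerAWeight (-1 / 2) ⧸
    ((V.kerAWeight 0).map (V.ρ (e .B))).submoduleOf (V.kerAWeight (-1 / 2))

end OspModule

end

end Osp12

/-!
The proof replaces cochains by functions on words in the basis vectors `H, X, Y, A, B`, on which the
contractions `ι_c`, the Lie derivatives `L_a` and the coboundary `∂` are defined recursively, with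
Cartan's formula `ι_a ∂ + ∂ ι_a = L_a` as the definition of `∂`. The signs depending on the parity of a
cochain are absorbed into the twisted action `v ↦ (-1)^{av} a v` (`tw`), which satisfies a mirrored module
law (`IsRep`); `d_toMulti` identifies the resulting `∂` with the coboundary of multilinear cochains.

Since `H` acts diagonalizably and `L_H = ι_H ∂ + ∂ ι_H`, every cocycle is cohomologous to its part of
weight zero (`sub_pr_eq`), so only cochains with `L_H F = 0` matter. Among them consider those relative to
`H`, i.e. with `ι_H F = 0`. The relations `[A, A] = 2X` and `[B, B] = -2Y` give explicit formulas for the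
components of `∂F` on words `A ⋯ A B ⋯ B`, possibly preceded by `Y` (`cf_dW`, `cf_ι_Y_dW`). They show
that a relative cocycle is determined by these components (`eq_zero_of_cocycle`), and, as `A` is
surjective, that a primitive can be found component by component, the only obstruction being in degree
`0` and in the values on the single letters `A` and `B` (`exact_relative`). Thus the relative cohomology
vanishes in degrees `n ≥ 2`. In degree `0` it is `ker A ∩ ker B`, because `A` and `B` generate the algebra.
In degree `1` it is `(ker A)^{-1/2} / B((ker A)^0)`: subtracting a coboundary `∂u` makes the value on `A`
zero, and then the value on `B`, well defined up to the choice of `u`, is killed by `A` (`classVec_mem`,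
`classVec_eq_iff`, `exists_relative_one`).

Finally, if `F` is of weight zero then `ι_H` anticommutes with `∂` on `F`, and `ι_H F` is a relative
cochain, so absolute and relative cohomology fit into a long exact sequence whose connecting map
raises the degree by two. That map is zero, since it ends in degrees `≥ 2`; hence the absolute cohomology
in degree `n` is the sum of the relative ones in degrees `n` and `n - 1` (`exact_of_contraction`,
`exists_contraction_eq`), which is the theorem.
-/

namespace Osp12

/-! ### Structure constants -/

/-- Twice the structure constants of `osp(1|2)` in the basis `H, X, Y, A, B`. The factor two makes
them integers, so that identities between them are decidable. -/
def dbl : Gen → Gen → Gen → ℤ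
  | .H, .X, .X => 2
  | .H, .Y, .Y => -2
  | .H, .A, .A => 1
  | .H, .B, .B => -1
  | .X, .H, .X => -2
  | .X, .Y, .H => 4
  | .X, .B, .A => -2
  | .Y, .H, .Y => 2
  | .Y, .X, .H => -4
  | .Y, .A, .B => -2
  | .A, .H, .A => -1
  | .A, .Y, .B => 2
  | .A, .A, .X => 4
  | .A, .B, .H => 4
  | .B, .H, .B => 1
  | .B, .X, .A => 2
  | .B, .A, .H => 4
  | .B, .B, .Y => -4
  | _, _, _ => 0

theorem brTable_apply (a b c : Gen) : brTable a b c = (dbl a b c : ℝ) / 2 := by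
  cases a <;> cases b <;> cases c <;> norm_num [brTable, e, dbl, Pi.single_apply] <;> decide

/-- The structure constants of `osp(1|2)`: the coefficient of `c` in `[a, b]`. -/
noncomputable def sc (a b c : Gen) : ℂ := (dbl a b c : ℂ) / 2

theorem brTable_smul {M : Type*} [AddCommGroup M] [Module ℂ M] (a b c : Gen) (v : M) :
    brTable a b c • v = sc a b c • v := by
  rw [brTable_apply, sc, ← Complex.coe_smul]
  push_cast
  rfl

/-- The sign `(-1)^{ab}` of two basis vectors, as a complex scalar. -/
noncomputable def sg (a b : Gen) : ℂ := sgn (par a * par b)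

theorem sum_gen {N : Type*} [AddCommMonoid N] (f : Gen → N) :
    ∑ c, f c = f .H + (f .X + (f .Y + (f .A + f .B))) := by
  simp [Finset.univ, Fintype.elems]

theorem sg_comm (a b : Gen) : sg a b = sg b a := by simp only [sg, mul_comm]

theorem sg_mul_self (a b : Gen) : sg a b * sg a b = 1 := by
  rw [sg, ← Int.cast_mul]
  have : sgn (par a * par b) * sgn (par a * par b) = 1 := by
    revert a b
    decide
  rw [this, Int.cast_one]

/-- The weight of a basis vector: its eigenvalue under `[H, ·]`. -/
noncomputable def wtg : Gen → ℂ
  | .H => 0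
  | .X => 1
  | .Y => -1
  | .A => 1 / 2
  | .B => -1 / 2

theorem sc_antisymm (a b c : Gen) : sc b a c = -(sg a b * sc a b c) := by
  have : dbl b a c = -(sgn (par a * par b) * dbl a b c) := by
    revert a b c
    decide
  rw [sc, this, sc, sg]
  push_cast
  ring

theorem sg_of_sc_ne_zero {a b c : Gen} (h : sc a b c ≠ 0) (x : Gen) : sg c x = sg a x * sg b x := by
  have h' : dbl a b c ≠ 0 := by
    intro h0
    simp [sc, h0] at h
  have : sgn (par c * par x) = sgn (par a * par x) * sgn (par b * par x) := by
    clear h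
    revert a b c x
    decide
  rw [sg, this, sg, sg, Int.cast_mul]

theorem wtg_of_sc_ne_zero {a b c : Gen} (h : sc a b c ≠ 0) : wtg c = wtg a + wtg b := by
  revert h
  cases a <;> cases b <;> cases c <;> norm_num [sc, dbl, wtg]

theorem sc_H (a c : Gen) : sc .H a c = if c = a then wtg a else 0 := by
  cases a <;> cases c <;> norm_num [sc, dbl, wtg] <;> decide

/-- The graded Jacobi identity. -/
theorem jacobi (a b c x : Gen) :
    ∑ m, sc a b m * sc m c x =
      ∑ m, sc b c m * sc a m x - sg a b * ∑ m, sc a c m * sc b m x := by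
  have h : ∑ m, dbl a b m * dbl m c x =
      ∑ m, dbl b c m * dbl a m x - sgn (par a * par b) * ∑ m, dbl a c m * dbl b m x := by
    revert x c b
    cases a <;> decide +kernel
  simp only [sum_gen, sc, sg] at h ⊢
  have h' := congrArg (fun z : ℤ => (z : ℂ) / 4) h
  push_cast at h'
  linear_combination h'

/-! ### Cartan calculus on functions on words -/

theorem sg_eq (a b : Gen) : sg a b = 1 ∨ sg a b = -1 :=
  mul_self_eq_one_iff.mp (sg_mul_self a b)

/-- Cochains of all degrees at once, given by their values on words in the basis vectors. -/
abbrev WordFun (M : Type*) : Type _ := List Gen → M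

section

variable {M : Type*} [AddCommGroup M] [Module ℂ M]

/-- The contraction `ι_c`, inserting the basis vector `c` as the first argument. -/
def ι (c : Gen) : Module.End ℂ (WordFun M) where
  toFun F w := F (c :: w)
  map_add' _ _ := rfl
  map_smul' _ _ := rfl

@[simp] theorem ι_apply (c : Gen) (F : WordFun M) (w : List Gen) : ι c F w = F (c :: w) := rfl

/-- The contraction with the bracket `[a, b]`. -/
noncomputable def ιbr (a b : Gen) : Module.End ℂ (WordFun M) := ∑ c, sc a b c • ι c

/-- The twisted module law: it is satisfied by the operators `v ↦ (-1)^{av} a v` of an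
`osp(1|2)`-module, i.e. by the associated right action. -/
def IsRep (r : Gen → Module.End ℂ M) : Prop :=
  ∀ a b, ∑ c, sc a b c • r c = sg a b • (r a * r b) - r b * r a

variable (r : Gen → Module.End ℂ M)

/-- The value on a word of the Lie derivative along `a`, by recursion on the word. -/
noncomputable def lieAt (a : Gen) : List Gen → (WordFun M →ₗ[ℂ] M)
  | [] => r a ∘ₗ LinearMap.proj []
  | b :: w => sg a b • (lieAt a w ∘ₗ ι b) - LinearMap.proj w ∘ₗ ιbr a b

/-- The Lie derivative along the basis vector `a`. -/
noncomputable def lie (a : Gen) : Module.End ℂ (WordFun M) := LinearMap.pi (lieAt r a)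

/-- The value on a word of the coboundary, by recursion on the word. -/
noncomputable def dAt : List Gen → (WordFun M →ₗ[ℂ] M)
  | [] => 0
  | a :: w => LinearMap.proj w ∘ₗ lie r a - dAt w ∘ₗ ι a

/-- The coboundary operator, defined through Cartan's formula `ι_a ∂ + ∂ ι_a = L_a`. -/
noncomputable def dW : Module.End ℂ (WordFun M) := LinearMap.pi (dAt r)

@[simp] theorem lie_nil (a : Gen) (F : WordFun M) : lie r a F [] = r a (F []) := rfl

@[simp] theorem dW_nil (F : WordFun M) : dW r F [] = 0 := rfl

theorem ι_mul_lie (a b : Gen) :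
    ι b * lie r a = sg a b • (lie r a * ι b) - (ιbr a b : Module.End ℂ (WordFun M)) := rfl

theorem ι_mul_dW (a : Gen) : ι a * dW r = lie r a - dW r * ι a := rfl

/-- An operator on cochains is zero if it vanishes in degree zero and commutes with all contractions
up to scalars. -/
theorem eq_zero_of_intertwine {E : Module.End ℂ (WordFun M)} (h0 : ∀ F, E F [] = 0)
    (h : ∀ b, ∃ c : ℂ, ι b * E = c • (E * ι b)) : E = 0 := by
  have key : ∀ (w : List Gen) (F : WordFun M), E F w = 0 := by
    intro w
    induction w with
    | nil => exact h0
    | cons b w ih =>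
      intro F
      obtain ⟨c, hc⟩ := h b
      have := congrFun (LinearMap.congr_fun hc F) w
      simp only [Module.End.mul_apply, ι_apply, LinearMap.smul_apply, Pi.smul_apply] at this
      rw [this, ih, smul_zero]
  ext F w
  exact key w F

theorem sum_sc_ιbr (a b c : Gen) :
    ∑ m, sc a b m • (ιbr m c : Module.End ℂ (WordFun M)) =
      ∑ m, sc b c m • ιbr a m - sg a b • ∑ m, sc a c m • ιbr b m := by
  have h (s : Gen → ℂ) (t : Gen → Gen → ℂ) :
      ∑ m, s m • ∑ x, t m x • (ι x : Module.End ℂ (WordFun M)) =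
        ∑ x, (∑ m, s m * t m x) • ι x := by
    simp only [Finset.smul_sum, Finset.sum_smul, smul_smul]
    exact Finset.sum_comm
  simp only [ιbr, h]
  rw [Finset.smul_sum, ← Finset.sum_sub_distrib]
  refine Finset.sum_congr rfl fun x _ => ?_
  rw [jacobi]
  module

theorem ιbr_mul_lie (a b c : Gen) :
    ιbr b c * lie r a = (sg a b * sg a c) • (lie r a * ιbr b c) -
      ∑ m, sc b c m • (ιbr a m : Module.End ℂ (WordFun M)) := by
  rw [ιbr, Finset.sum_mul, Finset.mul_sum, Finset.smul_sum, ← Finset.sum_sub_distrib]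
  refine Finset.sum_congr rfl fun m _ => ?_
  rw [smul_mul_assoc, ι_mul_lie, mul_smul_comm, smul_sub, smul_smul, smul_smul]
  by_cases h : sc b c m = 0
  · simp [h]
  · rw [sg_comm a m, sg_of_sc_ne_zero h, sg_comm a b, sg_comm a c, mul_comm (sc b c m)]

theorem ιbr_comm (a b : Gen) : (ιbr b a : Module.End ℂ (WordFun M)) = -(sg a b • ιbr a b) := by
  simp only [ιbr, Finset.smul_sum, ← Finset.sum_neg_distrib]
  refine Finset.sum_congr rfl fun c _ => ?_
  rw [sc_antisymm a b]
  module

variable {r}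

theorem lie_bracket (hr : IsRep r) (a b : Gen) :
    ∑ c, sc a b c • lie r c = sg a b • (lie r a * lie r b) - lie r b * lie r a := by
  rw [← sub_eq_zero]
  refine eq_zero_of_intertwine (fun F => ?_) fun c => ⟨sg a c * sg b c, ?_⟩
  · have := LinearMap.congr_fun (hr a b) (F [])
    simp only [LinearMap.sum_apply, LinearMap.smul_apply, LinearMap.sub_apply,
      Module.End.mul_apply] at this
    simp [Finset.sum_apply, this]
  · have h1 : ι c * ∑ m, sc a b m • lie r m = (sg a c * sg b c) • ((∑ m, sc a b m • lie r m) * ι c) -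
        ∑ m, sc a b m • (ιbr m c : Module.End ℂ (WordFun M)) := by
      rw [Finset.sum_mul, Finset.mul_sum, Finset.smul_sum, ← Finset.sum_sub_distrib]
      refine Finset.sum_congr rfl fun m _ => ?_
      rw [mul_smul_comm, ι_mul_lie, smul_mul_assoc, smul_sub, smul_smul, smul_smul]
      by_cases h : sc a b m = 0
      · simp [h]
      · rw [sg_of_sc_ne_zero h, mul_comm (sc a b m)]
    have h2 (x y : Gen) : ι c * (lie r x * lie r y) =
        (sg x c * sg y c) • (lie r x * lie r y * ι c) - sg x c • (lie r x * ιbr y c) -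
          (sg y x * sg y c) • (lie r y * ιbr x c) +
          ∑ m, sc x c m • (ιbr y m : Module.End ℂ (WordFun M)) := by
      rw [← mul_assoc, ι_mul_lie, sub_mul, ιbr_mul_lie, smul_mul_assoc, mul_assoc, ι_mul_lie, mul_sub,
        mul_smul_comm, ← mul_assoc]
      module
    rw [mul_sub, h1, mul_sub, mul_smul_comm, h2, h2, sum_sc_ιbr, sg_comm b a, sub_mul, sub_mul,
      smul_mul_assoc]
    rcases sg_eq a b with h | h <;> rcases sg_eq a c with h' | h' <;>
      rcases sg_eq b c with h'' | h'' <;> rw [h, h', h''] <;> module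

theorem lie_mul_dW (hr : IsRep r) (a : Gen) : lie r a * dW r = dW r * lie r a := by
  rw [← sub_eq_zero]
  refine eq_zero_of_intertwine (fun F => ?_) fun b => ⟨-sg a b, ?_⟩
  · simp
  · have h := lie_bracket hr a b
    have h1 : ιbr a b * dW r = ∑ c, sc a b c • lie r c - dW r * ιbr a b := by
      rw [ιbr, Finset.sum_mul, Finset.mul_sum, ← Finset.sum_sub_distrib]
      refine Finset.sum_congr rfl fun m _ => ?_
      rw [smul_mul_assoc, mul_smul_comm, ι_mul_dW, smul_sub]
    rw [mul_sub, ← mul_assoc, ι_mul_lie, sub_mul, h1, h, smul_mul_assoc, mul_assoc, ι_mul_dW, mul_sub,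
      ← mul_assoc (ι b), ι_mul_dW, sub_mul, mul_assoc (dW r), ι_mul_lie, mul_sub, mul_smul_comm,
      sub_mul, mul_assoc, mul_assoc]
    module

theorem dW_mul_dW (hr : IsRep r) : dW r * dW r = 0 := by
  refine eq_zero_of_intertwine (fun F => by simp) fun b => ⟨1, ?_⟩
  rw [← mul_assoc, ι_mul_dW, sub_mul, lie_mul_dW hr, mul_assoc, ι_mul_dW, mul_sub, one_smul, mul_assoc]
  abel

variable (M) in
/-- The graded antisymmetric cochains: exchanging two neighbouring letters `a`, `b` of a word
multiplies the value by `-(-1)^{ab}`. -/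
def anti : Submodule ℂ (WordFun M) where
  carrier := {F | ∀ p a b w, F (p ++ a :: b :: w) = -(sg a b • F (p ++ b :: a :: w))}
  add_mem' hF hG p a b w := by
    simp only [Pi.add_apply, hF p a b w, hG p a b w, smul_add]
    abel
  zero_mem' := by simp
  smul_mem' c F hF p a b w := by
    simp only [Pi.smul_apply, hF p a b w, smul_neg]
    rw [smul_comm]

theorem ι_ι {F : WordFun M} (hF : F ∈ anti M) (a b : Gen) : ι a (ι b F) = -(sg a b • ι b (ι a F)) := by
  ext w
  have := hF [] b a w
  rw [sg_comm] at this
  exact this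

theorem ι_mem {F : WordFun M} (hF : F ∈ anti M) (a : Gen) : ι a F ∈ anti M :=
  fun p b c w => hF (a :: p) b c w

theorem ιbr_mem {F : WordFun M} (hF : F ∈ anti M) (a b : Gen) : ιbr a b F ∈ anti M := by
  rw [ιbr, LinearMap.sum_apply]
  exact Submodule.sum_mem _ fun c _ => Submodule.smul_mem _ _ (ι_mem hF c)

/-- An operator preserves graded antisymmetry if it commutes with contractions up to scalars and
operators preserving it, and if it creates no symmetric part in the first two arguments. -/
theorem mem_anti_of {E : WordFun M → WordFun M}
    (h0 : ∀ F ∈ anti M, ∀ a b, ι a (ι b (E F)) = -(sg a b • ι b (ι a (E F))))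
    (h : ∀ F ∈ anti M, ∀ a, ∃ c : ℂ, ∃ G ∈ anti M, ∃ K ∈ anti M, ι a (E F) = c • E G + K)
    {F : WordFun M} (hF : F ∈ anti M) : E F ∈ anti M := by
  intro p
  induction p generalizing F with
  | nil =>
    intro a b w
    have := congrFun (h0 F hF b a) w
    rw [sg_comm] at this
    exact this
  | cons x p ih =>
    intro a b w
    obtain ⟨c, G, hG, K, hK, hE⟩ := h F hF x
    have h1 (w) : E F (x :: w) = c • E G w + K w := congrFun hE w
    rw [List.cons_append, List.cons_append, h1, h1, ih hG, hK p a b w]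
    module

theorem ι_lie (a b : Gen) (F : WordFun M) :
    ι b (lie r a F) = sg a b • lie r a (ι b F) - ιbr a b F := rfl

theorem ι_dW (a : Gen) (F : WordFun M) : ι a (dW r F) = lie r a F - dW r (ι a F) := rfl

theorem ι_ιbr {F : WordFun M} (hF : F ∈ anti M) (a b c : Gen) :
    ι a (ιbr b c F) = -((sg a b * sg a c) • ιbr b c (ι a F)) := by
  simp only [ιbr, LinearMap.sum_apply, map_sum, Finset.smul_sum, ← Finset.sum_neg_distrib,
    LinearMap.smul_apply, map_smul]
  refine Finset.sum_congr rfl fun m _ => ?_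
  by_cases h : sc b c m = 0
  · simp [h]
  · rw [ι_ι hF, sg_comm a m, sg_of_sc_ne_zero h, sg_comm a b, sg_comm a c]
    module

theorem lie_mem (a : Gen) {F : WordFun M} (hF : F ∈ anti M) : lie r a F ∈ anti M := by
  refine mem_anti_of (E := lie r a) (fun F hF b c => ?_) (fun F hF b => ⟨sg a b, ι b F, ι_mem hF b,
    -ιbr a b F, neg_mem (ιbr_mem hF a b), by rw [ι_lie, sub_eq_add_neg]⟩) hF
  simp only [ι_lie, map_sub, map_smul, ι_ιbr hF, ι_ι hF b c, map_neg, sg_comm c a, sg_comm c b,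
    sg_comm b a]
  rcases sg_eq a b with h | h <;> rcases sg_eq a c with h' | h' <;>
    rcases sg_eq b c with h'' | h'' <;> rw [h, h', h''] <;> module

theorem dW_mem {F : WordFun M} (hF : F ∈ anti M) : dW r F ∈ anti M := by
  refine mem_anti_of (E := dW r) (fun F hF b c => ?_) (fun F hF b => ⟨-1, ι b F, ι_mem hF b,
    lie r b F, lie_mem b hF, by rw [ι_dW]; module⟩) hF
  simp only [ι_lie, ι_dW, map_sub, ι_ι hF b c, map_neg, map_smul, sg_comm c b, ιbr_comm b c,
    LinearMap.neg_apply, LinearMap.smul_apply]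
  rcases sg_eq b c with h'' | h'' <;> rw [h''] <;> module

/-- Exterior multiplication by the dual basis vector of an even basis vector `c`, at a word. -/
def wedgeAt (c : Gen) : List Gen → (WordFun M →ₗ[ℂ] M)
  | [] => 0
  | a :: w => (if a = c then LinearMap.proj w else 0) - wedgeAt c w ∘ₗ ι a

/-- Exterior multiplication by the dual basis vector of an even basis vector `c`. -/
def wedge (c : Gen) : Module.End ℂ (WordFun M) := LinearMap.pi (wedgeAt c)

@[simp] theorem wedge_nil (c : Gen) (F : WordFun M) : wedge c F [] = 0 := rfl

theorem ι_wedge (c a : Gen) (F : WordFun M) :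
    ι a (wedge c F) = (if a = c then F else 0) - wedge c (ι a F) := by
  ext w
  by_cases h : a = c <;> simp [wedge, wedgeAt, h]

theorem wedge_mem {c : Gen} (hc : par c = 0) {F : WordFun M} (hF : F ∈ anti M) :
    wedge c F ∈ anti M := by
  have h1 (x) : sg c x = 1 := by simp [sg, hc, sgn]
  refine mem_anti_of (E := wedge c) (fun F hF a b => ?_) (fun F hF b => ⟨-1, ι b F, ι_mem hF b,
    if b = c then F else 0, ?_, by rw [ι_wedge]; module⟩) hF
  · simp only [ι_wedge, map_sub, ι_ι hF a b, map_neg, map_smul]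
    by_cases ha : a = c
    · subst ha
      by_cases hb : b = a
      · subst hb
        simp [h1]
      · simp [h1, hb]
    · by_cases hb : b = c
      · subst hb
        simp [sg_comm a b, h1, ha]
      · simp [ha, hb]
  · split_ifs
    exacts [hF, zero_mem _]

end

section

variable {M : Type*} [AddCommGroup M] [Module ℂ M]

/-! ### Weights -/

section FunctionalCalculus

variable {T : Module.End ℂ M}

theorem ext_eigenspace (hT : ⨆ μ, T.eigenspace μ = ⊤) {N : Type*} [AddCommGroup N] [Module ℂ N]
    {f g : M →ₗ[ℂ] N} (h : ∀ μ, ∀ v ∈ T.eigenspace μ, f v = g v) : f = g := by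
  rw [← LinearMap.eqLocus_eq_top, eq_top_iff, ← hT]
  exact iSup_le h

theorem bijective_coeLinearMap (hT : ⨆ μ, T.eigenspace μ = ⊤) :
    Function.Bijective (DirectSum.coeLinearMap T.eigenspace) :=
  DirectSum.isInternal_submodule_of_iSupIndep_of_iSup_eq_top T.eigenspaces_iSupIndep hT

variable (hT : ⨆ μ, T.eigenspace μ = ⊤)

/-- The operator `c(T)`, for `T` diagonalizable and `c` any function on `ℂ`: it acts as the scalar
`c μ` on the eigenspace of `T` for `μ`. -/
noncomputable def fcalc (c : ℂ → ℂ) : Module.End ℂ M :=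
  DirectSum.toModule ℂ ℂ M (fun μ => c μ • (T.eigenspace μ).subtype) ∘ₗ
    (LinearEquiv.ofBijective (DirectSum.coeLinearMap T.eigenspace)
      (bijective_coeLinearMap hT)).symm.toLinearMap

theorem fcalc_apply (c : ℂ → ℂ) {μ : ℂ} {v : M} (hv : v ∈ T.eigenspace μ) :
    fcalc hT c v = c μ • v := by
  have : v = LinearEquiv.ofBijective (DirectSum.coeLinearMap T.eigenspace)
      (bijective_coeLinearMap hT) (DirectSum.lof ℂ ℂ (fun μ => T.eigenspace μ) μ ⟨v, hv⟩) := by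
    rw [LinearEquiv.ofBijective_apply, DirectSum.coeLinearMap_lof]
  rw [fcalc, LinearMap.comp_apply]
  conv_lhs => rw [this]
  rw [LinearEquiv.coe_coe, LinearEquiv.symm_apply_apply, DirectSum.toModule_lof]
  rfl

/-- The projection onto the eigenspace of `T` for `α`. -/
noncomputable def wproj (α : ℂ) : Module.End ℂ M := fcalc hT fun μ => if μ - α = 0 then 1 else 0

theorem wproj_eq {α : ℂ} {v : M} (hv : v ∈ T.eigenspace α) : wproj hT α v = v := by
  simp [wproj, fcalc_apply hT _ hv]

theorem wproj_mem (α : ℂ) (v : M) : wproj hT α v ∈ T.eigenspace α := by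
  rw [Module.End.mem_eigenspace_iff]
  change (T ∘ₗ wproj hT α) v = (α • wproj hT α) v
  congr 1
  refine ext_eigenspace hT fun μ v hv => ?_
  simp only [wproj, LinearMap.comp_apply, LinearMap.smul_apply, fcalc_apply hT _ hv, map_smul,
    Module.End.mem_eigenspace_iff.mp hv]
  by_cases h : μ = α
  · simp [h]
  · simp [sub_eq_zero, h]

end FunctionalCalculus

variable {r : Gen → Module.End ℂ M}

theorem r_mem_eigenspace (hr : IsRep r) (a : Gen) {μ : ℂ} {v : M} (hv : v ∈ (r .H).eigenspace μ) :
    r a v ∈ (r .H).eigenspace (μ + wtg a) := by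
  have h := LinearMap.congr_fun (hr .H a) v
  have h1 : sg .H a = 1 := by simp [sg, par, sgn]
  rw [Module.End.mem_eigenspace_iff] at hv ⊢
  simp only [sc_H, ite_smul, zero_smul, Finset.sum_ite_eq', Finset.mem_univ, if_true, h1, one_smul,
    LinearMap.smul_apply, LinearMap.sub_apply, Module.End.mul_apply, hv, map_smul] at h
  rw [add_smul, h]
  abel

/-- The weight of a word. -/
noncomputable def wt (w : List Gen) : ℂ := (w.map wtg).sum

@[simp] theorem wt_nil : wt [] = 0 := rfl

@[simp] theorem wt_cons (a : Gen) (w : List Gen) : wt (a :: w) = wtg a + wt w := by simp [wt]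

variable (hT : ⨆ μ, (r .H).eigenspace μ = ⊤)

theorem r_fcalc (hr : IsRep r) (a : Gen) (κ : ℂ → ℂ) (s : ℂ) (v : M) :
    r a (fcalc hT (fun μ => κ (μ - s)) v) = fcalc hT (fun μ => κ (μ - (s + wtg a))) (r a v) := by
  change (r a ∘ₗ fcalc hT _) v = (fcalc hT _ ∘ₗ r a) v
  congr 1
  refine ext_eigenspace hT fun μ v hv => ?_
  rw [LinearMap.comp_apply, LinearMap.comp_apply, fcalc_apply hT _ hv,
    fcalc_apply hT _ (r_mem_eigenspace hr a hv), map_smul, add_sub_add_right_eq_sub]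

/-- The operator `κ(L_H - s)` on cochains: it acts on the value at a word `w` as
`κ(H - s - wt w)`. -/
noncomputable def Φ (κ : ℂ → ℂ) (s : ℂ) : Module.End ℂ (WordFun M) :=
  LinearMap.pi fun w => fcalc hT (fun μ => κ (μ - (s + wt w))) ∘ₗ LinearMap.proj w

theorem Φ_apply (κ : ℂ → ℂ) (s : ℂ) (F : WordFun M) (w : List Gen) :
    Φ hT κ s F w = fcalc hT (fun μ => κ (μ - (s + wt w))) (F w) := rfl

theorem ι_Φ (κ : ℂ → ℂ) (s : ℂ) (a : Gen) (F : WordFun M) :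
    ι a (Φ hT κ s F) = Φ hT κ (s + wtg a) (ι a F) := by
  ext w
  simp only [ι_apply, Φ_apply, wt_cons, add_assoc]

theorem Φ_mem (κ : ℂ → ℂ) (s : ℂ) {F : WordFun M} (hF : F ∈ anti M) : Φ hT κ s F ∈ anti M := by
  intro p a b w
  have : wt (p ++ a :: b :: w) = wt (p ++ b :: a :: w) := by
    simp [wt, add_left_comm]
  rw [Φ_apply, Φ_apply, this, hF, map_neg, map_smul]

theorem ιbr_Φ (κ : ℂ → ℂ) (s : ℂ) (a b : Gen) (F : WordFun M) :
    ιbr a b (Φ hT κ s F) = Φ hT κ (s + wtg a + wtg b) (ιbr a b F) := by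
  simp only [ιbr, LinearMap.sum_apply, map_sum, LinearMap.smul_apply, map_smul]
  refine Finset.sum_congr rfl fun m _ => ?_
  by_cases h : sc a b m = 0
  · simp [h]
  · rw [ι_Φ, wtg_of_sc_ne_zero h, add_assoc]

theorem lie_Φ (hr : IsRep r) (κ : ℂ → ℂ) (s : ℂ) (a : Gen) (F : WordFun M) :
    lie r a (Φ hT κ s F) = Φ hT κ (s + wtg a) (lie r a F) := by
  ext w
  induction w generalizing F s with
  | nil => simp only [lie_nil, Φ_apply, wt_nil, add_zero, r_fcalc hT hr]
  | cons b w ih =>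
    change (ι b (lie r a _)) w = (ι b (Φ hT κ _ _)) w
    rw [ι_lie, ι_Φ, ι_Φ, ι_lie, map_sub, map_smul, Pi.sub_apply, Pi.sub_apply, Pi.smul_apply,
      Pi.smul_apply, ih, ιbr_Φ, add_right_comm]

theorem dW_Φ (hr : IsRep r) (κ : ℂ → ℂ) (s : ℂ) (F : WordFun M) :
    dW r (Φ hT κ s F) = Φ hT κ s (dW r F) := by
  ext w
  induction w generalizing F s with
  | nil => simp [Φ_apply]
  | cons a w ih =>
    change (ι a (dW r _)) w = (ι a (Φ hT κ _ _)) w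
    rw [ι_dW, ι_Φ, ι_Φ, ι_dW, map_sub, Pi.sub_apply, Pi.sub_apply, ih, lie_Φ hT hr]

theorem lie_H_apply (F : WordFun M) (w : List Gen) :
    lie r .H F w = r .H (F w) - wt w • F w := by
  induction w generalizing F with
  | nil => simp
  | cons b w ih =>
    have h1 : sg .H b = 1 := by simp [sg, par, sgn]
    have h2 : ιbr .H b F = wtg b • ι b F := by
      simp [ιbr, sc_H, ite_smul]
    change (ι b (lie r .H F)) w = _
    rw [ι_lie, h1, one_smul, h2, Pi.sub_apply, ih, wt_cons, Pi.smul_apply, ι_apply]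
    module

/-- The projection of cochains onto those of weight zero, i.e. onto the kernel of `L_H`. -/
noncomputable def pr : Module.End ℂ (WordFun M) := Φ hT (fun x => if x = 0 then 1 else 0) 0

theorem pr_apply (F : WordFun M) (w : List Gen) : pr hT F w = wproj hT (wt w) (F w) := by
  simp only [pr, Φ_apply, zero_add, wproj]

theorem pr_mem {F : WordFun M} (hF : F ∈ anti M) : pr hT F ∈ anti M := Φ_mem hT _ _ hF

theorem dW_pr (hr : IsRep r) (F : WordFun M) : dW r (pr hT F) = pr hT (dW r F) := dW_Φ hT hr _ _ F

theorem ι_H_pr (F : WordFun M) : ι .H (pr hT F) = pr hT (ι .H F) := by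
  rw [pr, ι_Φ, wtg, add_zero]

theorem lie_H_eq_zero_iff (F : WordFun M) :
    lie r .H F = 0 ↔ ∀ w, F w ∈ (r .H).eigenspace (wt w) := by
  simp only [funext_iff, lie_H_apply, Pi.zero_apply, sub_eq_zero, Module.End.mem_eigenspace_iff]

theorem lie_H_pr (F : WordFun M) : lie r .H (pr hT F) = 0 := by
  rw [lie_H_eq_zero_iff]
  intro w
  rw [pr_apply]
  exact wproj_mem hT _ _

theorem pr_eq {F : WordFun M} (hF : lie r .H F = 0) : pr hT F = F := by
  ext w
  rw [pr_apply]
  exact wproj_eq hT ((lie_H_eq_zero_iff F).mp hF w)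

/-- A cocycle is cohomologous to its weight zero part: `L_H` is invertible on the other weights,
and it is homotopic to zero. -/
theorem sub_pr_eq (hr : IsRep r) {F : WordFun M} (hF : dW r F = 0) :
    F - pr hT F = dW r (ι .H (Φ hT (fun x => x⁻¹) 0 F)) := by
  have h : dW r (ι .H (Φ hT (fun x => x⁻¹) 0 F)) = lie r .H (Φ hT (fun x => x⁻¹) 0 F) := by
    have := ι_dW (r := r) .H (Φ hT (fun x => x⁻¹) 0 F)
    rw [dW_Φ hT hr, hF, map_zero, map_zero] at this
    exact (sub_eq_zero.mp this.symm).symm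
  rw [h]
  ext w
  rw [lie_H_apply, Pi.sub_apply, pr_apply, Φ_apply]
  change ((LinearMap.id : M →ₗ[ℂ] M) - wproj hT (wt w)) (F w) =
    (r .H ∘ₗ fcalc hT (fun μ => (μ - (0 + wt w))⁻¹) -
      wt w • fcalc hT (fun μ => (μ - (0 + wt w))⁻¹)) (F w)
  congr 1
  refine ext_eigenspace hT fun μ v hv => ?_
  have hv' := Module.End.mem_eigenspace_iff.mp hv
  simp only [LinearMap.sub_apply, LinearMap.id_apply, LinearMap.comp_apply, LinearMap.smul_apply,
    wproj, fcalc_apply hT _ hv, map_smul, hv', zero_add]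
  by_cases h : μ - wt w = 0
  · simp [h]
  · rw [if_neg h, zero_smul, sub_zero, smul_smul, smul_smul, ← sub_smul, mul_comm _ μ, ← sub_mul,
      mul_inv_cancel₀ h, one_smul]

end

section

variable {M : Type*} [AddCommGroup M] [Module ℂ M]

/-! ### Components of cochains -/

theorem sg_A_A : sg .A .A = -1 := by simp [sg, par, sgn, ZMod.val_one]

theorem sg_A_B : sg .A .B = -1 := by simp [sg, par, sgn, ZMod.val_one]

theorem sg_B_A : sg .B .A = -1 := by simp [sg, par, sgn, ZMod.val_one]

theorem sg_B_B : sg .B .B = -1 := by simp [sg, par, sgn, ZMod.val_one]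

theorem sg_of_even {a : Gen} (h : par a = 0) (b : Gen) : sg a b = 1 := by simp [sg, h, sgn]

theorem sg_of_even' {b : Gen} (h : par b = 0) (a : Gen) : sg a b = 1 := by simp [sg, h, sgn]

theorem ιbr_A_A : (ιbr .A .A : Module.End ℂ (WordFun M)) = (2 : ℂ) • ι .X := by
  norm_num [ιbr, sum_gen, sc, dbl]

theorem ιbr_B_B : (ιbr .B .B : Module.End ℂ (WordFun M)) = (-2 : ℂ) • ι .Y := by
  norm_num [ιbr, sum_gen, sc, dbl]

theorem ιbr_A_B : (ιbr .A .B : Module.End ℂ (WordFun M)) = (2 : ℂ) • ι .H := by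
  norm_num [ιbr, sum_gen, sc, dbl]

theorem ιbr_Y_A : (ιbr .Y .A : Module.End ℂ (WordFun M)) = -ι .B := by
  norm_num [ιbr, sum_gen, sc, dbl]
  module

theorem ιbr_Y_B : (ιbr .Y .B : Module.End ℂ (WordFun M)) = 0 := by
  norm_num [ιbr, sum_gen, sc, dbl]

theorem ιbr_H_H : (ιbr .H .H : Module.End ℂ (WordFun M)) = 0 := by
  norm_num [ιbr, sum_gen, sc, dbl]

theorem pow_ι_mem {F : WordFun M} (hF : F ∈ anti M) (a : Gen) (k : ℕ) : (ι a ^ k) F ∈ anti M := by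
  induction k with
  | zero => exact hF
  | succ k ih =>
    rw [pow_succ', Module.End.mul_apply]
    exact ι_mem ih a

theorem ι_pow_ι {F : WordFun M} (hF : F ∈ anti M) (a b : Gen) (k : ℕ) :
    ι a ((ι b ^ k) F) = (-sg a b) ^ k • (ι b ^ k) (ι a F) := by
  induction k with
  | zero => simp
  | succ k ih =>
    rw [pow_succ' (ι b), Module.End.mul_apply, ι_ι (pow_ι_mem hF b k), ih, Module.End.mul_apply, map_smul]
    module

theorem ι_ι_self {F : WordFun M} (hF : F ∈ anti M) {a : Gen} (ha : par a = 0) : ι a (ι a F) = 0 := by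
  have h := ι_ι hF a a
  rw [sg_of_even ha, one_smul] at h
  have h2 : (2 : ℂ) • ι a (ι a F) = 0 := by
    rw [two_smul]
    exact eq_neg_iff_add_eq_zero.mp h
  exact (smul_eq_zero.mp h2).resolve_left two_ne_zero

variable {r : Gen → Module.End ℂ M}

/-- Cartan's formula iterated for an odd basis vector `c` with `[c, c] = 2 ε x`. Where the subtractions
`k - 1` and `k - 2` truncate, their terms have coefficient zero. -/
theorem pow_ι_dW {c x : Gen} {ε : ℂ} (hc : sg c c = -1) (hx : par x = 0)
    (hb : (ιbr c c : Module.End ℂ (WordFun M)) = (2 * ε) • ι x) {F : WordFun M} (hF : F ∈ anti M)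
    (k : ℕ) :
    (ι c ^ k) (dW r F) = (-1 : ℂ) ^ k • (dW r ((ι c ^ k) F) - (k : ℂ) • lie r c ((ι c ^ (k - 1)) F) -
      (k * (k - 1) * ε : ℂ) • ι x ((ι c ^ (k - 2)) F)) := by
  induction k with
  | zero => simp
  | succ k ih =>
    have hs (G : WordFun M) (k : ℕ) : ι c ((ι c ^ k) G) = (ι c ^ (k + 1)) G := by
      rw [pow_succ', Module.End.mul_apply]
    rw [← hs, ih]
    simp only [map_smul, map_sub, ι_dW, ι_lie, hc, hb, LinearMap.smul_apply, hs]
    rcases k with _ | _ | k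
    · simp
    · simp
      module
    · rw [ι_ι (pow_ι_mem hF c _) c x, sg_of_even' hx, hs]
      simp only [Nat.add_sub_cancel, show k + 1 + 1 + 1 - 2 = k + 1 by omega,
        show k + 1 + 1 - 2 = k by omega, show k + 1 + 1 - 1 = k + 1 by omega, Nat.cast_add,
        Nat.cast_one]
      module

/-- The value of a cochain on the word `A ⋯ A B ⋯ B`. -/
def cf (F : WordFun M) (a b : ℕ) : M := (ι .B ^ b) ((ι .A ^ a) F) []

theorem cf_eq (F : WordFun M) (a b : ℕ) :
    cf F a b = F (List.replicate a .A ++ List.replicate b .B) := by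
  have h (c : Gen) (k : ℕ) (w : List Gen) (F : WordFun M) :
      (ι c ^ k) F w = F (List.replicate k c ++ w) := by
    induction k generalizing F with
    | zero => rfl
    | succ k ih => rw [pow_succ, Module.End.mul_apply, ih, ι_apply, List.replicate_succ, List.cons_append]
  rw [cf, h, h, List.append_nil]

theorem cf_add (F G : WordFun M) (a b : ℕ) : cf (F + G) a b = cf F a b + cf G a b := by simp [cf]

theorem cf_sub (F G : WordFun M) (a b : ℕ) : cf (F - G) a b = cf F a b - cf G a b := by simp [cf]

theorem cf_zero (a b : ℕ) : cf (0 : WordFun M) a b = 0 := by simp [cf]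

theorem cf_ι_B {F : WordFun M} (hF : F ∈ anti M) (a b : ℕ) : cf (ι .B F) a b = cf F a (b + 1) := by
  have := ι_pow_ι hF .B .A a
  rw [sg_B_A, neg_neg, one_pow, one_smul] at this
  rw [cf, cf, ← this, pow_succ, Module.End.mul_apply]

theorem pow_ι_B_lie_A {F : WordFun M} (hF : F ∈ anti M) (hH : ι .H F = 0) (b : ℕ) :
    (ι .B ^ b) (lie r .A F) = (-1 : ℂ) ^ b • lie r .A ((ι .B ^ b) F) := by
  induction b with
  | zero => simp
  | succ b ih =>
    rw [pow_succ', Module.End.mul_apply, ih, map_smul, ι_lie, ιbr_A_B, LinearMap.smul_apply,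
      ι_pow_ι hF .H, hH, sg_A_B, Module.End.mul_apply]
    simp only [map_zero, smul_zero, sub_zero]
    module

theorem pow_ι_A_lie_Y {F : WordFun M} (hF : F ∈ anti M) (a : ℕ) :
    (ι .A ^ a) (lie r .Y F) = lie r .Y ((ι .A ^ a) F) + (a : ℂ) • (ι .A ^ (a - 1)) (ι .B F) := by
  induction a generalizing F with
  | zero => simp
  | succ a ih =>
    rw [pow_succ, Module.End.mul_apply, ι_lie, sg_of_even rfl, one_smul, ιbr_Y_A, LinearMap.neg_apply,
      sub_neg_eq_add, map_add, ih (ι_mem hF _), ι_ι hF .B, sg_B_A, Module.End.mul_apply,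
      Nat.add_sub_cancel]
    rcases a with _ | a
    · simp
    · rw [Nat.add_sub_cancel, pow_succ, Module.End.mul_apply]
      simp only [map_neg, map_smul, Nat.cast_add, Nat.cast_one]
      module

/-- The components on the words `A ⋯ A B ⋯ B` of the coboundary of a cochain relative to `H`. Where a
subtraction on the right hand side truncates, its term has coefficient zero. -/
theorem cf_dW {F : WordFun M} (hF : F ∈ anti M) (hH : ι .H F = 0) (a b : ℕ) :
    cf (dW r F) a b =
      (-1 : ℂ) ^ (a + b) • (-((b : ℂ) • r .B (cf F a (b - 1))) - (a : ℂ) • r .A (cf F (a - 1) b)) +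
      (b * (b - 1) : ℂ) • cf (ι .Y F) a (b - 2) - (a * (a - 1) : ℂ) • cf (ι .X F) (a - 2) b := by
  have hHk (k : ℕ) : ι .H ((ι .A ^ k) F) = 0 := by rw [ι_pow_ι hF, hH, map_zero, smul_zero]
  have hX : ((a * (a - 1) : ℂ)) • (ι .X ((ι .A ^ (a - 2)) F)) =
      ((-1) ^ a * (a * (a - 1)) : ℂ) • (ι .A ^ (a - 2)) (ι .X F) := by
    rcases a with _ | _ | a
    · simp
    · simp
    · rw [ι_pow_ι hF, sg_of_even rfl, show a + 1 + 1 - 2 = a by omega]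
      module
  have hY : ((b * (b - 1) : ℂ)) • (ι .Y ((ι .B ^ (b - 2)) ((ι .A ^ a) F))) =
      ((-1) ^ (a + b) * (b * (b - 1)) : ℂ) • (ι .B ^ (b - 2)) ((ι .A ^ a) (ι .Y F)) := by
    rcases b with _ | _ | b
    · simp
    · simp
    · rw [ι_pow_ι (pow_ι_mem hF _ _), ι_pow_ι hF, sg_of_even rfl, sg_of_even rfl,
        show b + 1 + 1 - 2 = b by omega, map_smul]
      module
  rw [cf, pow_ι_dW (x := .X) (ε := 1) sg_A_A rfl (by rw [ιbr_A_A, mul_one]) hF, mul_one, hX, map_smul,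
    map_sub, map_sub, map_smul, map_smul,
    pow_ι_dW (x := .Y) (ε := -1) sg_B_B rfl (by rw [ιbr_B_B]; norm_num) (pow_ι_mem hF _ _),
    pow_ι_B_lie_A (pow_ι_mem hF _ _) (hHk _), mul_neg_one, neg_smul, hY]
  simp only [Pi.smul_apply, Pi.sub_apply, Pi.neg_apply, dW_nil, lie_nil]
  simp only [cf]
  simp only [pow_add]
  rcases neg_one_pow_eq_or ℂ a with h | h <;> rcases neg_one_pow_eq_or ℂ b with h' | h' <;>
    rw [h, h'] <;> module

/-- The components of a coboundary on the words `Y A ⋯ A B ⋯ B`. -/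
theorem cf_ι_Y_dW {F : WordFun M} (hF : F ∈ anti M) (a b : ℕ) :
    cf (ι .Y (dW r F)) a b =
      r .Y (cf F a b) + (a : ℂ) • cf F (a - 1) (b + 1) - cf (dW r (ι .Y F)) a b := by
  have h (b : ℕ) (F : WordFun M) : (ι .B ^ b) (lie r .Y F) = lie r .Y ((ι .B ^ b) F) := by
    induction b with
    | zero => rfl
    | succ b ih =>
      rw [pow_succ', Module.End.mul_apply, ih, ι_lie, ιbr_Y_B, sg_of_even rfl, one_smul,
        LinearMap.zero_apply, sub_zero, Module.End.mul_apply]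
  rw [ι_dW, cf_sub, cf, pow_ι_A_lie_Y hF, map_add, h, map_smul, Pi.add_apply, Pi.smul_apply, lie_nil,
    ← cf, ← cf, cf_ι_B hF]

/-- A cochain vanishing on words with an even letter is determined by its components. -/
theorem eq_zero_of_cf₀ {F : WordFun M} (hF : F ∈ anti M) (hH : ι .H F = 0) (hX : ι .X F = 0)
    (hY : ι .Y F = 0) (h : ∀ a b, cf F a b = 0) : F = 0 := by
  ext w
  induction w generalizing F with
  | nil => exact h 0 0
  | cons c w ih =>
    change ι c F w = 0
    have hc (x : Gen) (hx : ι x F = 0) : ι x (ι c F) = 0 := by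
      rw [ι_ι hF, hx, map_zero, smul_zero, neg_zero]
    have key (h' : ∀ a b, cf (ι c F) a b = 0) : ι c F w = 0 :=
      ih (ι_mem hF c) (hc _ hH) (hc _ hX) (hc _ hY) h'
    cases c with
    | H => rw [hH]; rfl
    | X => rw [hX]; rfl
    | Y => rw [hY]; rfl
    | A => exact key fun a b => h (a + 1) b
    | B => exact key fun a b => by rw [cf_ι_B hF, h]

/-- A cochain relative to `H` is determined by its components. -/
theorem eq_zero_of_cf {F : WordFun M} (hF : F ∈ anti M) (hH : ι .H F = 0)
    (h : ∀ a b, cf F a b = 0) (hX : ∀ a b, cf (ι .X F) a b = 0) (hY : ∀ a b, cf (ι .Y F) a b = 0)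
    (hXY : ∀ a b, cf (ι .X (ι .Y F)) a b = 0) : F = 0 := by
  have hc {F : WordFun M} (hF : F ∈ anti M) (c : Gen) {x : Gen} (hx : ι x F = 0) :
      ι x (ι c F) = 0 := by
    rw [ι_ι hF, hx, map_zero, smul_zero, neg_zero]
  have key {F : WordFun M} (hF : F ∈ anti M) (hH : ι .H F = 0) (hY' : ι .Y F = 0)
      (h : ∀ a b, cf F a b = 0) (hX : ∀ a b, cf (ι .X F) a b = 0) : F = 0 :=
    eq_zero_of_cf₀ hF hH (eq_zero_of_cf₀ (ι_mem hF _) (hc hF _ hH) (ι_ι_self hF rfl) (hc hF _ hY') hX)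
      hY' h
  exact key hF hH (key (ι_mem hF _) (hc hF _ hH) (ι_ι_self hF rfl) hY hXY) h hX

/-- The components on words containing `X` of a cocycle relative to `H` are determined by the others,
as `[A, A] = 2X`. -/
theorem eq_zero_of_cocycle {F : WordFun M} (hF : F ∈ anti M) (hH : ι .H F = 0) (hd : dW r F = 0)
    (h : ∀ a b, cf F a b = 0) (hY : ∀ a b, cf (ι .Y F) a b = 0) : F = 0 := by
  have hne (a : ℕ) : (((a + 2 : ℕ) : ℂ) * ((a + 2 : ℕ) - 1)) ≠ 0 := by
    have : ((a + 2 : ℕ) : ℂ) - 1 = (a + 1 : ℕ) := by push_cast; ring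
    rw [this]
    exact mul_ne_zero (Nat.cast_ne_zero.mpr (by omega)) (Nat.cast_ne_zero.mpr (by omega))
  refine eq_zero_of_cf hF hH h (fun a b => ?_) hY fun a b => ?_
  · have := cf_dW (r := r) hF hH (a + 2) b
    simp only [hd, h, hY, cf_zero, map_zero, smul_zero, neg_zero, sub_zero, add_zero,
      zero_sub, zero_eq_neg] at this
    exact (smul_eq_zero.mp this).resolve_left (hne a)
  · have := cf_ι_Y_dW (r := r) hF (a + 2) b
    rw [cf_dW (ι_mem hF _) (by rw [ι_ι hF, hH, map_zero, smul_zero, neg_zero]), ι_ι_self hF rfl] at this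
    simp only [hd, h, hY, cf_zero, map_zero, smul_zero, neg_zero, sub_zero, add_zero,
      zero_sub, neg_neg] at this
    exact (smul_eq_zero.mp this.symm).resolve_left (hne a)

/-- The cochain vanishing on words with an even letter, with prescribed values on the others. -/
def base (p : ℕ → ℕ → M) : WordFun M := fun w =>
  if ∀ c ∈ w, par c = 1 then p (w.count .A) (w.count .B) else 0

theorem base_mem (p : ℕ → ℕ → M) : base p ∈ anti M := by
  intro q a b w
  have hp : (q ++ a :: b :: w).Perm (q ++ b :: a :: w) := (List.Perm.swap b a w).append_left q
  simp only [base, hp.mem_iff, hp.count_eq]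
  split_ifs with h
  · have ha : par a = 1 := h a (by simp)
    have hb : par b = 1 := h b (by simp)
    have : sg a b = -1 := by simp [sg, ha, hb, sgn, ZMod.val_one]
    rw [this]
    module
  · simp

theorem ι_base_of_even (p : ℕ → ℕ → M) {c : Gen} (hc : par c = 0) : ι c (base p) = 0 := by
  ext w
  simp [base, hc]

theorem cf_base (p : ℕ → ℕ → M) (a b : ℕ) : cf (base p) a b = p a b := by
  rw [cf_eq, base, if_pos]
  · simp [List.count_replicate]
  · intro c hc
    simp only [List.mem_append, List.mem_replicate] at hc
    rcases hc with ⟨_, rfl⟩ | ⟨_, rfl⟩ <;> rfl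

theorem cf_wedge {c : Gen} (hc : par c = 0) (F : WordFun M) (a b : ℕ) : cf (wedge c F) a b = 0 := by
  have h {x : Gen} (hx : x ≠ c) (k : ℕ) (F : WordFun M) :
      ∃ G : WordFun M, (ι x ^ k) (wedge c F) = wedge c G := by
    induction k with
    | zero => exact ⟨F, rfl⟩
    | succ k ih =>
      obtain ⟨G, hG⟩ := ih
      refine ⟨-ι x G, ?_⟩
      rw [pow_succ', Module.End.mul_apply, hG, ι_wedge, if_neg hx, zero_sub, map_neg]
  obtain ⟨G, hG⟩ := h (x := .A) (by rintro rfl; exact absurd hc (by decide)) a F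
  obtain ⟨K, hK⟩ := h (x := .B) (by rintro rfl; exact absurd hc (by decide)) b G
  rw [cf, hG, hK, wedge_nil]

/-- There are cochains relative to `H` with arbitrary components. -/
theorem exists_cochain (p pY pX pXY : ℕ → ℕ → M) : ∃ G ∈ anti M, ι .H G = 0 ∧
    (∀ a b, cf G a b = p a b) ∧ (∀ a b, cf (ι .Y G) a b = pY a b) ∧
    (∀ a b, cf (ι .X G) a b = pX a b) ∧ ∀ a b, cf (ι .X (ι .Y G)) a b = pXY a b := by
  refine ⟨base p + wedge .Y (base pY) + wedge .X (base pX) - wedge .X (wedge .Y (base pXY)),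
    sub_mem (add_mem (add_mem (base_mem _) (wedge_mem rfl (base_mem _))) (wedge_mem rfl (base_mem _)))
      (wedge_mem rfl (wedge_mem rfl (base_mem _))), ?_, ?_, ?_, ?_, ?_⟩
  all_goals
    have hH (q : ℕ → ℕ → M) : ι .H (base q) = 0 := ι_base_of_even q rfl
    have hX (q : ℕ → ℕ → M) : ι .X (base q) = 0 := ι_base_of_even q rfl
    have hY (q : ℕ → ℕ → M) : ι .Y (base q) = 0 := ι_base_of_even q rfl
    have hwX := cf_wedge (M := M) (c := .X) rfl
    have hwY := cf_wedge (M := M) (c := .Y) rfl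
    simp [ι_wedge, hH, hX, hY, cf_add, cf_sub, cf_base, hwX, hwY]

end

/-! ### Exactness of the complex relative to `H` -/

section

variable {M : Type*} [AddCommGroup M] [Module ℂ M] {r : Gen → Module.End ℂ M}

theorem r_A_r_B (hr : IsRep r) (v : M) : r .A (r .B v) + r .B (r .A v) = -((2 : ℂ) • r .H v) := by
  have h := LinearMap.congr_fun (hr .A .B) v
  norm_num [sum_gen, sc, dbl, sg_A_B] at h
  rw [h]
  abel

theorem r_X (hr : IsRep r) (v : M) : r .X v = -r .A (r .A v) := by
  have h := LinearMap.congr_fun (hr .A .A) v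
  norm_num [sum_gen, sc, dbl, sg_A_A] at h
  have h2 : (2 : ℂ) • (r .X v + r .A (r .A v)) = 0 := by
    rw [smul_add, h]
    module
  exact eq_neg_of_add_eq_zero_left ((smul_eq_zero.mp h2).resolve_left two_ne_zero)

theorem r_Y (hr : IsRep r) (v : M) : r .Y v = r .B (r .B v) := by
  have h := LinearMap.congr_fun (hr .B .B) v
  norm_num [sum_gen, sc, dbl, sg_B_B] at h
  have h2 : (2 : ℂ) • (r .Y v - r .B (r .B v)) = 0 := by
    rw [smul_sub, ← neg_inj, neg_sub, neg_zero]
    linear_combination (norm := module) h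
  exact sub_eq_zero.mp ((smul_eq_zero.mp h2).resolve_left two_ne_zero)

section

variable (hT : ⨆ μ, (r .H).eigenspace μ = ⊤)

theorem r_wproj (hr : IsRep r) (a : Gen) (α : ℂ) (v : M) :
    r a (wproj hT α v) = wproj hT (α + wtg a) (r a v) :=
  r_fcalc hT hr a (fun x => if x = 0 then 1 else 0) α v

theorem cf_pr_eq_zero {F : WordFun M} (c : List Gen) {a b : ℕ}
    (h : F (c ++ (List.replicate a .A ++ List.replicate b .B)) = 0) :
    pr hT F (c ++ (List.replicate a .A ++ List.replicate b .B)) = 0 := by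
  rw [pr_apply, h, map_zero]

end

theorem cf_mem {F : WordFun M} (h : lie r .H F = 0) (a b : ℕ) :
    cf F a b ∈ (r .H).eigenspace ((a - b) / 2) := by
  have : wt (List.replicate a .A ++ List.replicate b .B) = (a - b) / 2 := by
    simp [wt, wtg]
    ring
  rw [cf_eq, ← this]
  exact (lie_H_eq_zero_iff F).mp h _

/-- A cocycle of weight zero relative to `H`, without component in degree `0`, is a coboundary as soon
as its values on `A` and `B` are those of the coboundary of a vector `u` of weight zero: surjectivity
of `A` provides primitives of all other components. -/
theorem exact_relative (hT : ⨆ μ, (r .H).eigenspace μ = ⊤) (hr : IsRep r)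
    (hA : Function.Surjective (r .A)) {F : WordFun M} (hF : F ∈ anti M)
    (hH : ι .H F = 0) (hL : lie r .H F = 0) (hd : dW r F = 0) (h0 : F [] = 0)
    {u₀ : M} (hu₀ : r .H u₀ = 0) (hFA : F [.A] = r .A u₀) (hFB : F [.B] = r .B u₀) :
    ∃ G ∈ anti M, ι .H G = 0 ∧ lie r .H G = 0 ∧ dW r G = F := by
  have hsq (k : ℕ) : (-1 : ℂ) ^ k * (-1) ^ k = 1 := by rw [← mul_pow]; norm_num
  have hne (k : ℕ) : ((k : ℂ) + 2) * (k + 1) ≠ 0 := by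
    have h : ((k + 2 : ℕ) : ℂ) * (k + 1 : ℕ) ≠ 0 :=
      mul_ne_zero (Nat.cast_ne_zero.mpr (by omega)) (Nat.cast_ne_zero.mpr (by omega))
    push_cast at h
    exact h
  have hinv (k : ℕ) : ((k : ℂ) + 1 + 1) * (k + 1) * ((k + 1 : ℂ)⁻¹ * (k + 2 : ℂ)⁻¹) = 1 := by
    rw [← mul_inv, mul_comm ((k : ℂ) + 1) (k + 2), add_assoc (k : ℂ), one_add_one_eq_two,
      mul_inv_cancel₀ (hne k)]
  -- `u b` and `w b` are to be the components of the primitive on `B ⋯ B` and `Y B ⋯ B`, its components on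
  -- `A ⋯ A B ⋯ B` and `Y A ⋯ A B ⋯ B` with an `A` being zero. The component of `F` on `A B ⋯ B` prescribes
  -- `A (u b)`, and then the one on `B ⋯ B` prescribes `w b`.
  have hu : ∀ b : ℕ, ∃ u ∈ (r .H).eigenspace (-(b : ℂ) / 2), r .A u = (-1 : ℂ) ^ b • cf F 1 b ∧
      (b = 0 → u = u₀) := by
    intro b
    rcases b with _ | b
    · refine ⟨u₀, ?_, ?_, fun _ => rfl⟩
      · rw [Module.End.mem_eigenspace_iff, hu₀]
        simp
      · rw [pow_zero, one_smul, ← hFA]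
        rfl
    · obtain ⟨u, hu⟩ := hA ((-1 : ℂ) ^ (b + 1) • cf F 1 (b + 1))
      refine ⟨wproj hT (-((b + 1 : ℕ) : ℂ) / 2) u, wproj_mem hT _ _, ?_, fun h => absurd h (by omega)⟩
      rw [r_wproj hT hr, hu]
      refine wproj_eq hT (Submodule.smul_mem _ _ ?_)
      convert cf_mem hL 1 (b + 1) using 2
      rw [wtg]
      push_cast
      ring
  choose u hu1 hu2 hu3 using hu
  set w : ℕ → M := fun b => (((b : ℂ) + 2) * (b + 1))⁻¹ •
    (cf F 0 (b + 2) + ((-1 : ℂ) ^ b * (b + 2)) • r .B (u (b + 1))) with hw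
  have hw1 (b : ℕ) : (((b : ℂ) + 2) * (b + 1)) • w b =
      cf F 0 (b + 2) + ((-1 : ℂ) ^ b * (b + 2)) • r .B (u (b + 1)) := by
    rw [hw, smul_inv_smul₀ (hne b)]
  -- The cocycle condition on `A B ⋯ B` shows that this choice of `w` is compatible with the
  -- component of `F` on `Y A B ⋯ B`.
  have hw2 (b : ℕ) : cf (ι .Y F) 1 b = u (b + 1) - (-1 : ℂ) ^ b • r .A (w b) := by
    have h := cf_dW (r := r) hF hH 1 (b + 2)
    have hAw := congrArg (r .A) (hw1 b)
    have hAB := r_A_r_B hr (u (b + 1))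
    have hH' := Module.End.mem_eigenspace_iff.mp (hu1 (b + 1))
    rw [hu2, hH'] at hAB
    refine smul_right_injective M (hne b) ?_
    simp only [map_add, map_smul] at hAw hAB
    simp only [hd, cf_zero, Nat.sub_self, Nat.add_sub_cancel, show b + 2 - 1 = b + 1 by omega] at h
    push_cast at h hAB ⊢
    simp only [smul_sub]
    rw [smul_comm, hAw]
    rcases neg_one_pow_eq_or ℂ b with hs | hs <;> simp only [pow_add, hs] at h hAB ⊢ <;>
      linear_combination (norm := module) ((b : ℂ) + 2) • hAB - h
  -- The components on words containing `X` come from the component of `F` with two more letters `A`,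
  -- as `[A, A] = 2X`.
  obtain ⟨g, hg, hgH, hg1, hgY, hgX, hgXY⟩ := exists_cochain (M := M)
    (fun a b => if a = 0 then u b else 0) (fun a b => if a = 0 then w b else 0)
    (fun a b => -((((a : ℂ) + 2) * (a + 1))⁻¹ • cf F (a + 2) b))
    (fun a b => (((a : ℂ) + 2) * (a + 1))⁻¹ • cf (ι .Y F) (a + 2) b)
  have hcf (a b : ℕ) : cf (F - dW r g) a b = 0 := by
    rw [cf_sub, cf_dW hg hgH]
    simp only [hg1, hgY, hgX]
    rcases a with _ | _ | a
    · rcases b with _ | _ | b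
      · simpa [cf] using h0
      · have : cf F 0 1 = r .B u₀ := hFB
        simp [this, hu3]
      · simp
        linear_combination (norm := module) -hw1 b
    · simp
      rw [hu2, smul_smul, pow_add, mul_assoc, hsq]
      module
    · simp
      rw [smul_smul, hinv, one_smul, sub_self]
  have hcfY (a b : ℕ) (ha : a ≠ 0) : cf (ι .Y (F - dW r g)) a b = 0 := by
    rw [map_sub, cf_sub, cf_ι_Y_dW hg,
      cf_dW (ι_mem hg _) (by rw [ι_ι hg, hgH, map_zero, smul_zero, neg_zero]), ι_ι_self hg rfl]
    simp only [hg1, hgY, hgXY, cf_zero]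
    rcases a with _ | _ | a
    · exact absurd rfl ha
    · simp [hw2]
      module
    · simp
      rw [smul_smul, hinv, one_smul, sub_self]
  have hlie := lie_H_pr hT g
  have hHg : ι .H (pr hT g) = 0 := by rw [ι_H_pr, hgH, map_zero]
  refine ⟨pr hT g, pr_mem hT hg, hHg, hlie, ?_⟩
  have hpr : F - dW r (pr hT g) = pr hT (F - dW r g) := by
    rw [map_sub, pr_eq hT hL, dW_pr hT hr]
  have hanti : F - dW r (pr hT g) ∈ anti M := sub_mem hF (dW_mem (pr_mem hT hg))
  have hH' : ι .H (F - dW r (pr hT g)) = 0 := by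
    rw [map_sub, hH, ι_dW, hlie, hHg, map_zero, sub_zero, sub_zero]
  have hd' : dW r (F - dW r (pr hT g)) = 0 := by
    rw [map_sub, hd, ← Module.End.mul_apply, dW_mul_dW hr, LinearMap.zero_apply, sub_zero]
  have hcf' (a b : ℕ) : cf (F - dW r (pr hT g)) a b = 0 := by
    have h := hcf a b
    rw [cf_eq] at h
    rw [hpr, cf_eq]
    exact cf_pr_eq_zero hT [] h
  have hcfY' (a b : ℕ) : cf (ι .Y (F - dW r (pr hT g))) a b = 0 := by
    rcases Nat.eq_zero_or_pos a with rfl | ha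
    -- The component on `Y B ⋯ B` follows from the cocycle condition on `B ⋯ B`, as `[B, B] = -2Y`.
    · have h := cf_dW (r := r) hanti hH' 0 (b + 2)
      simp only [hd', hcf', cf_zero, map_zero, smul_zero, Nat.cast_zero, zero_mul, zero_smul, neg_zero,
        sub_zero, zero_add, Nat.add_sub_cancel] at h
      have h2 : ((b + 2 : ℕ) : ℂ) * ((b + 2 : ℕ) - 1) = (b + 2) * (b + 1) := by
        push_cast
        ring
      rw [h2] at h
      exact (smul_eq_zero.mp h.symm).resolve_left (hne b)
    · have h := hcfY a b ha.ne'
      rw [cf_eq] at h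
      rw [hpr, cf_eq]
      exact cf_pr_eq_zero hT [.Y] h
  exact (sub_eq_zero.mp (eq_zero_of_cocycle hanti hH' hd' hcf' hcfY')).symm

end

/-! ### Contraction with `H` -/

section

variable {M : Type*} [AddCommGroup M] [Module ℂ M] {r : Gen → Module.End ℂ M}

theorem lie_eq_zero_of_length (a : Gen) {w : List Gen} {F : WordFun M}
    (h : ∀ w' : List Gen, w'.length = w.length → F w' = 0) : lie r a F w = 0 := by
  induction w generalizing F with
  | nil => rw [lie_nil, h [] rfl, map_zero]
  | cons b w ih =>
    change ι b (lie r a F) w = 0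
    have h1 : lie r a (ι b F) w = 0 := ih fun w' hw => h (b :: w') (by simp [hw])
    have h2 : ιbr a b F w = 0 := by
      simp only [ιbr, LinearMap.sum_apply, LinearMap.smul_apply, Finset.sum_apply, Pi.smul_apply,
        ι_apply]
      exact Finset.sum_eq_zero fun c _ => by rw [h (c :: w) rfl, smul_zero]
    rw [ι_lie, Pi.sub_apply, Pi.smul_apply, h1, h2, smul_zero, sub_zero]

theorem dW_eq_zero_of_length {w : List Gen} {F : WordFun M}
    (h : ∀ w' : List Gen, w'.length + 1 = w.length → F w' = 0) : dW r F w = 0 := by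
  induction w generalizing F with
  | nil => rfl
  | cons a w ih =>
    change ι a (dW r F) w = 0
    rw [ι_dW, Pi.sub_apply, lie_eq_zero_of_length a fun w' hw => h w' (by simp [hw]),
      ih (F := ι a F) fun w' hw => h (a :: w') (by simp [hw]), sub_zero]

theorem lie_ι_H (F : WordFun M) : lie r .H (ι .H F) = ι .H (lie r .H F) := by
  rw [ι_lie, ιbr_H_H, sg_of_even rfl, one_smul, LinearMap.zero_apply, sub_zero]

theorem dW_dW (hr : IsRep r) (F : WordFun M) : dW r (dW r F) = 0 := by
  rw [← Module.End.mul_apply, dW_mul_dW hr, LinearMap.zero_apply]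

theorem lie_dW (hr : IsRep r) (a : Gen) (F : WordFun M) : lie r a (dW r F) = dW r (lie r a F) := by
  rw [← Module.End.mul_apply, lie_mul_dW hr, Module.End.mul_apply]

theorem dW_singleton (a : Gen) (F : WordFun M) : dW r F [a] = r a (F []) := by
  change ι a (dW r F) [] = _
  rw [ι_dW, Pi.sub_apply, lie_nil, dW_nil, sub_zero]

section

variable (hT : ⨆ μ, (r .H).eigenspace μ = ⊤)

theorem ι_H_pr_wedge {F : WordFun M} (hH : ι .H F = 0) (hL : lie r .H F = 0) :
    ι .H (pr hT (wedge .H F)) = F := by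
  rw [ι_H_pr, ι_wedge, if_pos rfl, hH, map_zero, sub_zero, pr_eq hT hL]

theorem pr_wedge_nil (c : Gen) (F : WordFun M) : pr hT (wedge c F) [] = 0 := by
  rw [pr_apply, wedge_nil, map_zero]

end

/-- A weight zero cocycle without components of degree `0` and `1` is a coboundary if the component of
degree one of its contraction with `H` agrees on `A` and `B` with the coboundary of a vector of weight
zero. -/
theorem exact_of_contraction (hT : ⨆ μ, (r .H).eigenspace μ = ⊤) (hr : IsRep r)
    (hA : Function.Surjective (r .A)) {F : WordFun M} (hF : F ∈ anti M) (hL : lie r .H F = 0)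
    (hd : dW r F = 0) (h0 : F [] = 0) (h1 : ∀ a, F [a] = 0) {u : M} (hu : r .H u = 0)
    (hFA : F [.H, .A] = r .A u) (hFB : F [.H, .B] = r .B u) : ∃ G ∈ anti M, dW r G = F := by
  have hd' : dW r (ι .H F) = 0 := by
    have := ι_dW (r := r) .H F
    rw [hd, hL, map_zero, zero_sub, zero_eq_neg] at this
    exact this
  obtain ⟨K, hK, hKH, hKL, hKd⟩ := exact_relative hT hr hA (ι_mem hF .H) (ι_ι_self hF rfl)
    (by rw [lie_ι_H, hL, map_zero]) hd' (h1 .H) hu hFA hFB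
  -- `W` is a weight zero cochain with `ι_H W = K`, so that `F + ∂W` is relative to `H`.
  set W := pr hT (wedge .H K) with hW
  have hWm : W ∈ anti M := pr_mem hT (wedge_mem rfl hK)
  have hWH : ι .H W = K := ι_H_pr_wedge hT hKH hKL
  have hWL : lie r .H W = 0 := lie_H_pr hT _
  have hWs (a : Gen) : (F + dW r W) [a] = 0 := by
    rw [Pi.add_apply, dW_singleton, h1, hW, pr_wedge_nil, map_zero, add_zero]
  obtain ⟨G, hG, -, -, hGd⟩ := exact_relative hT hr hA (add_mem hF (dW_mem hWm))
    (by rw [map_add, ι_dW, hWL, hWH, hKd, zero_sub, add_neg_cancel])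
    (by rw [map_add, hL, lie_dW hr, hWL, map_zero, add_zero])
    (by rw [map_add, hd, dW_dW hr, add_zero])
    (by rw [Pi.add_apply, h0, dW_nil, add_zero]) (map_zero _)
    (by rw [hWs, map_zero]) (by rw [hWs, map_zero])
  exact ⟨G - W, sub_mem hG hWm, by rw [map_sub, hGd, add_sub_cancel_right]⟩

/-- Every weight zero cocycle relative to `H` is the contraction with `H` of a cocycle: the obstruction
is a relative class of degree at least two. -/
theorem exists_contraction_eq (hT : ⨆ μ, (r .H).eigenspace μ = ⊤) (hr : IsRep r)
    (hA : Function.Surjective (r .A)) {F : WordFun M} (hF : F ∈ anti M) (hH : ι .H F = 0)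
    (hL : lie r .H F = 0) (hd : dW r F = 0) :
    ∃ G ∈ anti M, lie r .H G = 0 ∧ dW r G = 0 ∧ ι .H G = F := by
  set W := pr hT (wedge .H F) with hW
  have hWm : W ∈ anti M := pr_mem hT (wedge_mem rfl hF)
  have hWH : ι .H W = F := ι_H_pr_wedge hT hH hL
  have hWL : lie r .H W = 0 := lie_H_pr hT _
  have hWs (a : Gen) : dW r W [a] = 0 := by rw [dW_singleton, hW, pr_wedge_nil, map_zero]
  obtain ⟨K, hK, hKH, hKL, hKd⟩ := exact_relative hT hr hA (dW_mem hWm)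
    (by rw [ι_dW, hWL, hWH, hd, sub_zero]) (by rw [lie_dW hr, hWL, map_zero]) (dW_dW hr W)
    (dW_nil r W) (map_zero _) (by rw [hWs, map_zero]) (by rw [hWs, map_zero])
  exact ⟨W - K, sub_mem hWm hK, by rw [map_sub, hWL, hKL, sub_zero],
    by rw [map_sub, hKd, sub_self], by rw [map_sub, hWH, hKH, sub_zero]⟩

/-- A vector `v` of weight `-1/2` killed by `A` extends to a cocycle relative to `H` of degree one, with
value `0` on `A` and `v` on `B`. -/
theorem exists_relative_one (hT : ⨆ μ, (r .H).eigenspace μ = ⊤) (hr : IsRep r) {v : M}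
    (hvA : r .A v = 0) (hv : v ∈ (r .H).eigenspace (-1 / 2)) :
    ∃ F ∈ anti M, ι .H F = 0 ∧ lie r .H F = 0 ∧ dW r F = 0 ∧ F [.A] = 0 ∧ F [.B] = v := by
  obtain ⟨g, hg, hgH, hg1, hgY, hgX, hgXY⟩ := exists_cochain (M := M)
    (fun a b => if a = 0 ∧ b = 1 then v else 0) (fun a b => if a = 0 ∧ b = 0 then r .B v else 0)
    (fun _ _ => 0) (fun _ _ => 0)
  have hAB : r .A (r .B v) = v := by
    have := r_A_r_B hr v
    rw [hvA, Module.End.mem_eigenspace_iff.mp hv] at this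
    rw [map_zero, add_zero] at this
    rw [this]
    module
  have hcf (a b : ℕ) : cf (dW r g) a b = 0 := by
    rw [cf_dW hg hgH]
    simp only [hg1, hgY, hgX]
    rcases a with _ | _ | a
    · rcases b with _ | _ | _ | b
      · simp
      · simp
      · norm_num
      · simp
    · rcases b with _ | _ | b <;> simp [hvA]
    · simp
  have hcfY (a b : ℕ) : cf (ι .Y (dW r g)) a b = 0 := by
    rw [cf_ι_Y_dW hg, cf_dW (ι_mem hg _) (by rw [ι_ι hg, hgH, map_zero, smul_zero, neg_zero]),
      ι_ι_self hg rfl]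
    simp only [hg1, hgY, hgXY, cf_zero]
    rcases a with _ | _ | a
    · rcases b with _ | _ | b <;> simp [r_Y hr]
    · rcases b with _ | b <;> simp [hAB]
    · simp
  have hHg : ι .H (pr hT g) = 0 := by rw [ι_H_pr, hgH, map_zero]
  have hlie := lie_H_pr hT g
  refine ⟨pr hT g, pr_mem hT hg, hHg, hlie, ?_, ?_, ?_⟩
  · refine eq_zero_of_cocycle (r := r) (dW_mem (pr_mem hT hg)) ?_ (dW_dW hr _) (fun a b => ?_)
      fun a b => ?_
    · rw [ι_dW, hlie, hHg, map_zero, sub_zero]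
    · have h := hcf a b
      rw [cf_eq] at h
      rw [dW_pr hT hr, cf_eq]
      exact cf_pr_eq_zero hT [] h
    · have h := hcfY a b
      rw [cf_eq] at h
      rw [dW_pr hT hr, cf_eq]
      exact cf_pr_eq_zero hT [.Y] h
  · have : g [.A] = 0 := by
      have := hg1 1 0
      simpa [cf] using this
    rw [pr_apply, this, map_zero]
  · have : g [.B] = v := by
      have := hg1 0 1
      simpa [cf] using this
    rw [pr_apply, this]
    refine wproj_eq hT ?_
    simpa [wtg] using hv

/-- The cochain of degree zero attached to a vector. -/
def deg₀ (v : M) : WordFun M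
  | [] => v
  | _ :: _ => 0

theorem ι_deg₀ (a : Gen) (v : M) : ι a (deg₀ v) = 0 := rfl

theorem deg₀_mem (v : M) : deg₀ v ∈ anti M := by
  rintro (_ | ⟨c, p⟩) a b w <;> simp [deg₀]

theorem r_eq_zero (hr : IsRep r) {v : M} (hvA : r .A v = 0) (hvB : r .B v = 0) (a : Gen) :
    r a v = 0 := by
  cases a with
  | A => exact hvA
  | B => exact hvB
  | X => rw [r_X hr, hvA, map_zero, neg_zero]
  | Y => rw [r_Y hr, hvB, map_zero]
  | H =>
    have := r_A_r_B hr v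
    rw [hvA, hvB, map_zero, map_zero, add_zero, zero_eq_neg] at this
    exact (smul_eq_zero.mp this).resolve_left two_ne_zero

theorem lie_deg₀ {a : Gen} {v : M} (hv : r a v = 0) : lie r a (deg₀ v) = 0 := by
  ext w
  rcases w with _ | ⟨b, w⟩
  · exact hv
  · change ι b (lie r a (deg₀ v)) w = 0
    rw [ι_lie, ι_deg₀]
    simp [ιbr, ι_deg₀, LinearMap.sum_apply]

theorem dW_deg₀ {v : M} (hv : ∀ a, r a v = 0) : dW r (deg₀ v) = 0 := by
  ext w
  rcases w with _ | ⟨b, w⟩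
  · rfl
  · change ι b (dW r (deg₀ v)) w = 0
    rw [ι_dW, ι_deg₀, lie_deg₀ (hv b), map_zero, sub_zero]
    rfl

end

section

variable {M : Type*} [AddCommGroup M] [Module ℂ M]

/-! ### The coboundary formula -/

section Expansion

variable (r : Gen → Module.End ℂ M)

theorem sgn_add (x y : ZMod 2) : sgn (x + y) = sgn x * sgn y := by
  revert x y
  decide

theorem sg_smul (a b : Gen) (v : M) : sg a b • v = sgn (par a * par b) • v := by
  rw [sg, Int.cast_smul_eq_zsmul]

/-- The first sum of the coboundary formula, by recursion on the word of arguments. -/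
def actRec : List Gen → WordFun M → M
  | [], _ => 0
  | a :: w, F => sgn (par a * (w.map par).sum) • r a (F w) - actRec w (ι a F)

/-- The bracket part of the Lie derivative along `a`, by recursion on the word of arguments. -/
noncomputable def adRec (a : Gen) : List Gen → WordFun M → M
  | [], _ => 0
  | b :: w, F => ιbr a b F w + sg a b • adRec a w (ι b F)

/-- The second sum of the coboundary formula, by recursion on the word of arguments. -/
noncomputable def brRec : List Gen → WordFun M → M
  | [], _ => 0
  | a :: w, F => -adRec a w F - brRec w (ι a F)

theorem lie_eq (a : Gen) (w : List Gen) (F : WordFun M) :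
    lie r a F w = sgn (par a * (w.map par).sum) • r a (F w) - adRec a w F := by
  induction w generalizing F with
  | nil => simp [adRec, sgn]
  | cons b w ih =>
    change ι b (lie r a F) w = _
    rw [ι_lie, Pi.sub_apply, Pi.smul_apply, ih, adRec, smul_sub, List.map_cons, List.sum_cons, mul_add,
      sgn_add, mul_smul, sg_smul, ι_apply]
    abel

theorem dW_eq (w : List Gen) (F : WordFun M) : dW r F w = actRec r w F + brRec w F := by
  induction w generalizing F with
  | nil => simp [actRec, brRec]
  | cons a w ih =>
    change ι a (dW r F) w = _
    rw [ι_dW, Pi.sub_apply, ih, lie_eq, actRec, brRec]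
    abel

theorem sum_map_ofFn {n : ℕ} (u : Fin n → Gen) : ((List.ofFn u).map par).sum = ∑ k, par (u k) := by
  rw [List.map_ofFn, List.sum_ofFn]
  rfl

section Sums

variable {n : ℕ} {N : Type*} [AddCommMonoid N] (f : Fin (n + 1) → N)

theorem sum_lt_zero : ∑ k with k < 0, f k = 0 := by simp

theorem sum_zero_lt : ∑ k with 0 < k, f k = ∑ k : Fin n, f k.succ := by
  simp [Finset.sum_filter, Fin.sum_univ_succ]

theorem sum_lt_succ (i : Fin n) : ∑ k with k < i.succ, f k = f 0 + ∑ k with k < i, f k.succ := by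
  simp [Finset.sum_filter, Fin.sum_univ_succ]

theorem sum_succ_lt (i : Fin n) : ∑ k with i.succ < k, f k = ∑ k with i < k, f k.succ := by
  simp [Finset.sum_filter, Fin.sum_univ_succ]

theorem sum_lt_succ_ne_zero (j : Fin n) :
    ∑ k with k < j.succ ∧ k ≠ 0, f k = ∑ k with k < j, f k.succ := by
  simp [Finset.sum_filter, Fin.sum_univ_succ]

theorem sum_lt_succ_ne_succ (i j : Fin n) :
    ∑ k with k < j.succ ∧ k ≠ i.succ, f k = f 0 + ∑ k with k < j ∧ k ≠ i, f k.succ := by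
  simp [Finset.sum_filter, Fin.sum_univ_succ, (Fin.succ_ne_zero i).symm]

end Sums

theorem sgn_mul_self (x : ZMod 2) : sgn x * sgn x = 1 := by
  revert x
  decide

theorem actRec_ofFn {n : ℕ} (u : Fin (n + 1) → Gen) (F : WordFun M) :
    actRec r (List.ofFn u) F = ∑ i : Fin (n + 1),
      ((-1) ^ (i : ℕ) * sgn (par (u i) * ∑ k with i < k, par (u k))) •
        r (u i) (F (List.ofFn fun k => u (i.succAbove k))) := by
  induction n generalizing F with
  | zero =>
    refine Eq.trans ?_ (Fin.sum_univ_succ _).symm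
    rw [sum_zero_lt]
    simp [actRec]
  | succ n ih =>
    refine Eq.trans ?_ (Fin.sum_univ_succ _).symm
    rw [List.ofFn_succ, actRec, ih, sub_eq_add_neg, ← Finset.sum_neg_distrib, sum_map_ofFn, sum_zero_lt]
    congr 1
    · simp
    · refine Finset.sum_congr rfl fun i _ => ?_
      rw [List.ofFn_succ (f := fun k => u (i.succ.succAbove k)), sum_succ_lt]
      simp only [Fin.succ_succAbove_zero, Fin.succ_succAbove_succ, Fin.val_succ, pow_succ, ι_apply]
      rw [mul_neg_one, neg_mul, neg_smul]

theorem ιbr_cons {F : WordFun M} (hF : F ∈ anti M) (a b c : Gen) (w : List Gen) :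
    ιbr a b F (c :: w) =
      (-(sgn (par a * par c) * sgn (par b * par c))) • ιbr a b (ι c F) w := by
  have h := congrFun (ι_ιbr hF c a b) w
  rw [ι_apply] at h
  rw [h, Pi.neg_apply, Pi.smul_apply, sg_comm c a, sg_comm c b, sg, sg, ← Int.cast_mul,
    Int.cast_smul_eq_zsmul, neg_smul]

theorem adRec_ofFn (a : Gen) {n : ℕ} (u : Fin (n + 1) → Gen) {F : WordFun M} (hF : F ∈ anti M) :
    -adRec a (List.ofFn u) F = ∑ j : Fin (n + 1),
      ((-1) ^ ((j : ℕ) + 1) * sgn (par (u j) * ∑ k with k < j, par (u k))) •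
        ιbr a (u j) F (List.ofFn fun k => u (j.succAbove k)) := by
  induction n generalizing F with
  | zero => simp [adRec, sgn]
  | succ n ih =>
    refine Eq.trans ?_ (Fin.sum_univ_succ _).symm
    rw [List.ofFn_succ, adRec, neg_add, ← smul_neg, ih _ (ι_mem hF _), sg_smul, Finset.smul_sum]
    congr 1
    · simp [sgn]
    · refine Finset.sum_congr rfl fun j _ => ?_
      rw [List.ofFn_succ (f := fun k => u (j.succ.succAbove k)), sum_lt_succ]
      simp only [Fin.succ_succAbove_zero, Fin.succ_succAbove_succ, Fin.val_succ, pow_succ,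
        ιbr_cons hF, mul_add, sgn_add, smul_smul]
      congr 1
      have h2 := sgn_mul_self (par (u j.succ) * par (u 0))
      linear_combination ((-1) ^ (j : ℕ) * sgn (par (u j.succ) * ∑ k with k < j, par (u k.succ)) *
        sgn (par a * par (u 0))) * h2

theorem brRec_ofFn {n : ℕ} (u : Fin (n + 2) → Gen) {F : WordFun M} (hF : F ∈ anti M) :
    brRec (List.ofFn u) F = ∑ i : Fin (n + 1), ∑ j : Fin (n + 2) with i.castSucc < j,
      ((-1) ^ ((i : ℕ) + (j : ℕ)) * sgn (par (u i.castSucc) * ∑ k with k < i.castSucc, par (u k)) *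
        sgn (par (u j) * ∑ k with k < j ∧ k ≠ i.castSucc, par (u k))) •
      ιbr (u i.castSucc) (u j) F (List.ofFn fun k : Fin n => u (j.succAbove (i.succAbove k))) := by
  -- The terms with `i = 0`. The variable `z` stands for `Fin.castSucc 0`, which is not syntactically `0`.
  have h0 {n : ℕ} (u : Fin (n + 2) → Gen) {F : WordFun M} (hF : F ∈ anti M) (z : Fin (n + 2))
      (hz : z = 0) : -adRec (u 0) (List.ofFn fun k => u (Fin.succ k)) F =
      ∑ j : Fin (n + 2) with z < j,
      ((-1) ^ (((0 : Fin (n + 1)) : ℕ) + (j : ℕ)) * sgn (par (u z) * ∑ k with k < z, par (u k)) *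
        sgn (par (u j) * ∑ k with k < j ∧ k ≠ z, par (u k))) •
      ιbr (u z) (u j) F (List.ofFn fun k : Fin n => u (j.succAbove ((0 : Fin (n + 1)).succAbove k))) := by
    subst hz
    rw [adRec_ofFn _ _ hF, sum_zero_lt]
    refine Finset.sum_congr rfl fun j _ => ?_
    rw [sum_lt_zero, sum_lt_succ_ne_zero]
    simp [sgn]
  induction n generalizing F with
  | zero =>
    refine Eq.trans ?_ (Fin.sum_univ_succ _).symm
    rw [← h0 u hF (Fin.castSucc 0) rfl, List.ofFn_succ, brRec]
    simp [brRec, adRec]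
  | succ n ih =>
    refine Eq.trans ?_ (Fin.sum_univ_succ _).symm
    rw [← h0 u hF (Fin.castSucc 0) rfl, List.ofFn_succ, brRec, ih _ (ι_mem hF _), sub_eq_add_neg,
      ← Finset.sum_neg_distrib]
    · congr 1
      refine Finset.sum_congr rfl fun i _ => ?_
      refine Eq.trans ?_ (Finset.sum_filter _ _).symm
      refine Eq.trans ?_ (Fin.sum_univ_succ _).symm
      rw [if_neg (Fin.not_lt_zero _), zero_add, Finset.sum_filter, ← Finset.sum_neg_distrib]
      refine Finset.sum_congr rfl fun j _ => ?_
      simp only [Fin.castSucc_succ, Fin.succ_lt_succ_iff]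
      split_ifs
      · rw [List.ofFn_succ (f := fun k => u (j.succ.succAbove (i.succ.succAbove k))), sum_lt_succ,
          sum_lt_succ_ne_succ]
        simp only [Fin.succ_succAbove_zero, Fin.succ_succAbove_succ, Fin.val_succ,
          ιbr_cons hF, mul_add, sgn_add, smul_smul, ← neg_smul]
        congr 1
        have h1 := sgn_mul_self (par (u i.castSucc.succ) * par (u 0))
        have h2 := sgn_mul_self (par (u j.succ) * par (u 0))
        linear_combination ((-1) ^ ((i : ℕ) + j) *
          sgn (par (u i.castSucc.succ) * ∑ k with k < i.castSucc, par (u k.succ)) *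
          sgn (par (u j.succ) * ∑ k with k < j ∧ k ≠ i.castSucc, par (u k.succ))) *
          (sgn (par (u i.castSucc.succ) * par (u 0)) ^ 2 * h2 + h1)
      · simp

end Expansion

end

section

variable {M : Type*} [AddCommGroup M] [Module ℂ M]

/-! ### The twisted action -/

section Twist

variable (V : OspModule M)

theorem isHomog_e (a : Gen) : IsHomog (par a) (e a) := by
  intro b hb
  by_contra h
  exact hb (by rw [e, Pi.single_eq_of_ne]; rintro rfl; exact h rfl)

theorem br_e_e (a b : Gen) : br (e a) (e b) = brTable a b := by
  rw [br, Finset.sum_eq_single a, Finset.sum_eq_single b]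
  · simp [e]
  · intro c _ hc
    simp [e, hc]
  · simp
  · intro c _ hc
    simp [e, hc]
  · simp

theorem brTable_eq_sum (a b : Gen) : brTable a b = ∑ c, brTable a b c • e c := by
  ext x
  simp [e, Finset.sum_apply, Pi.single_apply]

theorem proj_mem (i : ZMod 2) (v : M) : V.proj i v ∈ V.gr i := Submodule.projection_apply_mem _ v

theorem proj_eq {i : ZMod 2} {v : M} (hv : v ∈ V.gr i) : V.proj i v = v :=
  Submodule.projection_apply_of_mem_left _ hv

theorem proj_eq_zero {i : ZMod 2} {v : M} (hv : v ∈ V.gr (i + 1)) : V.proj i v = 0 :=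
  Submodule.projection_apply_of_mem_right _ hv

theorem proj_add_proj (v : M) : V.proj 0 v + V.proj 1 v = v :=
  Submodule.projection_add_projection_eq_self V.isCompl v

theorem sum_proj (v : M) : ∑ p : ZMod 2, V.proj p v = v :=
  (Fin.sum_univ_two _).trans (proj_add_proj V v)

/-- The parity operator, equal to `(-1)^i` on `M_i`. -/
noncomputable def parityOp : Module.End ℂ M := V.proj 0 - V.proj 1

theorem parityOp_of_mem {i : ZMod 2} {v : M} (hv : v ∈ V.gr i) : parityOp V v = sgn i • v := by
  fin_cases i
  · change v ∈ V.gr 0 at hv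
    have h : V.proj 1 v = 0 := proj_eq_zero V hv
    change parityOp V v = sgn 0 • v
    rw [show sgn 0 = 1 from rfl, one_smul, parityOp, LinearMap.sub_apply, proj_eq V hv, h, sub_zero]
  · change v ∈ V.gr 1 at hv
    have h : V.proj 0 v = 0 := proj_eq_zero V hv
    change parityOp V v = sgn 1 • v
    rw [show sgn 1 = -1 from rfl, neg_smul, one_smul, parityOp, LinearMap.sub_apply, proj_eq V hv, h,
      zero_sub]

theorem parityOp_parityOp (v : M) : parityOp V (parityOp V v) = v := by
  conv_lhs => rw [← proj_add_proj V v]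
  simp only [map_add, parityOp_of_mem V (proj_mem V _ v), map_zsmul, smul_smul, sgn_mul_self, one_smul]
  exact proj_add_proj V v

theorem parityOp_ρ (a : Gen) (v : M) :
    parityOp V (V.ρ (e a) v) = sgn (par a) • V.ρ (e a) (parityOp V v) := by
  have h (i : ZMod 2) {v : M} (hv : v ∈ V.gr i) :
      parityOp V (V.ρ (e a) v) = sgn (par a) • V.ρ (e a) (parityOp V v) := by
    rw [parityOp_of_mem V (V.ρ_mem _ _ _ _ (isHomog_e a) hv), parityOp_of_mem V hv, map_zsmul, smul_smul,
      sgn_add]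
  rw [← proj_add_proj V v]
  simp only [map_add, smul_add]
  rw [h 0 (proj_mem V 0 v), h 1 (proj_mem V 1 v)]

/-- The twisted action `v ↦ (-1)^{av} a v` of a basis vector `a`. With it, the coboundary formula no
longer involves the parity of the cochain. -/
noncomputable def tw (a : Gen) : Module.End ℂ M := V.ρ (e a) * parityOp V ^ (par a).val

theorem tw_of_even {a : Gen} (h : par a = 0) : tw V a = V.ρ (e a) := by simp [tw, h]

theorem tw_of_odd {a : Gen} (h : par a = 1) (v : M) : tw V a v = V.ρ (e a) (parityOp V v) := by
  simp [tw, h, ZMod.val_one]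

theorem par_eq (a : Gen) : par a = 0 ∨ par a = 1 := by cases a <;> simp [par]

theorem ρ_bracket (a b : Gen) (v : M) : ∑ c, sc a b c • V.ρ (e c) v =
    V.ρ (e a) (V.ρ (e b) v) - sgn (par a * par b) • V.ρ (e b) (V.ρ (e a) v) := by
  rw [← V.ρ_br _ _ _ _ (isHomog_e a) (isHomog_e b), br_e_e]
  conv_rhs => rw [brTable_eq_sum, map_sum, LinearMap.sum_apply]
  refine Finset.sum_congr rfl fun c _ => ?_
  rw [map_smul, LinearMap.smul_apply, brTable_smul]

theorem par_of_sc_ne_zero {a b c : Gen} (h : sc a b c ≠ 0) : par c = par a + par b := by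
  have h' : dbl a b c ≠ 0 := by
    intro h0
    simp [sc, h0] at h
  clear h
  revert a b c
  decide

/-- Moving parity operators through odd elements turns the graded module law into the mirrored one. -/
theorem isRep_tw : IsRep (tw V) := by
  intro a b
  ext v
  simp only [LinearMap.sum_apply, LinearMap.smul_apply, LinearMap.sub_apply, Module.End.mul_apply,
    sg_smul]
  have key (P : M) (h : ∀ c, par c = par a + par b → tw V c v = V.ρ (e c) P) :
      ∑ c, sc a b c • tw V c v = ∑ c, sc a b c • V.ρ (e c) P := by
    refine Finset.sum_congr rfl fun c _ => ?_
    by_cases hc : sc a b c = 0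
    · rw [hc, zero_smul, zero_smul]
    · rw [h c (par_of_sc_ne_zero hc)]
  rcases par_eq a with ha | ha <;> rcases par_eq b with hb | hb
  · rw [key v fun c hc => by rw [tw_of_even V (by simp [hc, ha, hb])], ρ_bracket, tw_of_even V ha,
      tw_of_even V hb, ha, hb]
    simp [sgn]
  · rw [key (parityOp V v) fun c hc => by rw [tw_of_odd V (by simp [hc, ha, hb])], ρ_bracket,
      tw_of_even V ha, tw_of_odd V hb, tw_of_odd V hb, parityOp_ρ, ha, hb]
    simp [sgn]
  · rw [key (parityOp V v) fun c hc => by rw [tw_of_odd V (by simp [hc, ha, hb])], ρ_bracket,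
      tw_of_even V hb, tw_of_odd V ha, tw_of_odd V ha, parityOp_ρ, ha, hb]
    simp [sgn]
  · rw [key v fun c hc => by rw [tw_of_even V (by rw [hc, ha, hb]; rfl)], ρ_bracket, tw_of_odd V ha,
      tw_of_odd V hb, tw_of_odd V ha, tw_of_odd V hb, parityOp_ρ, parityOp_ρ, parityOp_parityOp, ha, hb]
    simp [sgn, ZMod.val_one]

/-- The sum over the parity `p` of the cochain absorbs its dependence on `p` into the twisted
action. -/
theorem sum_sgn_ρ_proj (a : Gen) (s t : ZMod 2) (v : M) :
    ∑ p : ZMod 2, sgn (par a * (p + s)) • V.ρ (e a) (V.proj (p + (s + t)) v) =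
      sgn (par a * t) • tw V a v := by
  rw [← Equiv.sum_comp (Equiv.subRight (s + t))]
  simp only [Equiv.subRight_apply, sub_add_cancel]
  rcases par_eq a with ha | ha
  · rw [ha, tw_of_even V ha]
    simp only [zero_mul, sgn, ZMod.val_zero, pow_zero, one_smul, ← map_sum, sum_proj]
  · rw [ha, tw_of_odd V ha]
    have h (p : ZMod 2) : sgn (p - (s + t) + s) = sgn t * sgn p := by
      rw [← sgn_add]
      revert p s t
      decide
    simp only [one_mul, h, mul_smul, ← Finset.smul_sum]
    congr 1
    refine (Fin.sum_univ_two _).trans ?_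
    change sgn 0 • V.ρ (e a) (V.proj 0 v) + sgn 1 • V.ρ (e a) (V.proj 1 v) = _
    simp [parityOp, sgn, ZMod.val_one, sub_eq_add_neg]

end Twist

/-! ### Multilinear cochains and functions on words -/

theorem ext_basis {n : ℕ} {f g : Multi M n}
    (h : ∀ u : Fin n → Gen, f (fun k => e (u k)) = g (fun k => e (u k))) : f = g := by
  refine Module.Basis.ext_multilinear (fun _ => Pi.basisFun ℝ Gen) fun u => ?_
  simp only [Pi.basisFun_apply]
  exact h u

/-- The `n`-linear map with prescribed values on words of length `n`. -/
noncomputable def toMulti (n : ℕ) (F : WordFun M) : Multi M n := ofBasis fun u => F (List.ofFn u)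

theorem toMulti_basis {n : ℕ} (F : WordFun M) (u : Fin n → Gen) :
    toMulti n F (fun k => e (u k)) = F (List.ofFn u) := ofBasis_basis _ u

/-- The values of an `n`-linear map on basis vectors, extended by zero to words of length other than
`n`. -/
noncomputable def toWord (n : ℕ) : Multi M n →ₗ[ℂ] WordFun M where
  toFun f w := if h : w.length = n then f (fun k => e (w.get (k.cast h.symm))) else 0
  map_add' f g := by
    ext w
    by_cases h : w.length = n <;> simp [h]
  map_smul' c f := by
    ext w
    by_cases h : w.length = n <;> simp [h]

theorem toWord_of_length {n : ℕ} (f : Multi M n) {w : List Gen} (h : w.length ≠ n) :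
    toWord n f w = 0 := dif_neg h

theorem toWord_ofFn {n : ℕ} (f : Multi M n) (u : Fin n → Gen) :
    toWord n f (List.ofFn u) = f (fun k => e (u k)) := by
  refine (dif_pos List.length_ofFn).trans ?_
  simp

theorem toMulti_toWord {n : ℕ} (f : Multi M n) : toMulti n (toWord n f) = f :=
  ext_basis fun u => by rw [toMulti_basis, toWord_ofFn]

theorem toWord_toMulti {n : ℕ} {F : WordFun M} {w : List Gen} (h : w.length = n) :
    toWord n (toMulti n F) w = F w := by
  subst h
  have h (u : Fin w.length → Gen) :
      toWord w.length (toMulti w.length F) (List.ofFn u) = F (List.ofFn u) := by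
    rw [toWord_ofFn, toMulti_basis]
  simpa only [List.ofFn_get] using h w.get

theorem toMulti_cons_br {n : ℕ} (F : WordFun M) (a b : Gen) (u : Fin n → Gen) :
    toMulti (n + 1) F (Fin.cons (br (e a) (e b)) fun k => e (u k)) = ιbr a b F (List.ofFn u) := by
  rw [← MultilinearMap.curryLeft_apply, br_e_e, brTable_eq_sum, map_sum]
  simp only [ιbr, LinearMap.sum_apply, _root_.sum_apply, Finset.sum_apply]
  refine Finset.sum_congr rfl fun c _ => ?_
  rw [map_smul, _root_.smul_apply, brTable_smul, LinearMap.smul_apply, Pi.smul_apply, ι_apply,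
    MultilinearMap.curryLeft_apply]
  congr 1
  have : (Fin.cons (e c) fun k => e (u k) : Fin (n + 1) → Osp) =
      fun k => e ((Fin.cons c u : Fin (n + 1) → Gen) k) := by
    ext k : 1
    refine Fin.cases ?_ (fun k => ?_) k <;> simp
  rw [this, toMulti_basis, List.ofFn_cons]

theorem bracketSum_toMulti {n : ℕ} {F : WordFun M} (hF : F ∈ anti M) (u : Fin (n + 1) → Gen) :
    bracketSum (toMulti n F) (fun k => par (u k)) (fun k => e (u k)) = brRec (List.ofFn u) F := by
  rcases n with _ | n
  · simp [bracketSum, brRec, adRec]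
  · rw [brRec_ofFn u hF]
    refine Finset.sum_congr rfl fun i _ => Finset.sum_congr rfl fun j _ => ?_
    rw [toMulti_cons_br]

/-- The operator `∂` defined by Cartan's formula is the coboundary of multilinear cochains. -/
theorem d_toMulti (V : OspModule M) {n : ℕ} {F : WordFun M} (hF : F ∈ anti M) :
    V.d n (toMulti n F) = toMulti (n + 1) (dW (tw V) F) := by
  refine ext_basis fun u => ?_
  rw [toMulti_basis, dW_eq]
  refine (ofBasis_basis _ u).trans ?_
  rw [OspModule.dBasis, Finset.sum_add_distrib]
  congr 1
  · rw [actRec_ofFn]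
    simp only [OspModule.actionSum]
    rw [Finset.sum_comm]
    refine Finset.sum_congr rfl fun i _ => ?_
    simp only [OspModule.component, ofBasis_basis, mul_smul, ← Finset.smul_sum]
    congr 1
    rw [← sum_sgn_ρ_proj V (u i) (∑ k with k < i, par (u k))]
    refine Finset.sum_congr rfl fun p _ => ?_
    have hs : ∑ k, par (u (i.succAbove k)) = ∑ k with k < i, par (u k) + ∑ k with i < k, par (u k) := by
      have h1 := Fin.sum_univ_succAbove (fun k => par (u k)) i
      have h2 : ∑ k, par (u k) = ∑ k with k < i, par (u k) + (par (u i) + ∑ k with i < k, par (u k)) := by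
        have h3 (k) : par (u k) = (if k < i then par (u k) else 0) +
            ((if k = i then par (u k) else 0) + if i < k then par (u k) else 0) := by
          rcases lt_trichotomy k i with h | h | h
          · simp [h, h.ne, h.not_gt]
          · simp [h]
          · simp [h, h.ne', h.not_gt]
        rw [Finset.sum_congr rfl fun k _ => h3 k, Finset.sum_add_distrib, Finset.sum_add_distrib,
          Finset.sum_ite_eq', if_pos (Finset.mem_univ i), Finset.sum_filter, Finset.sum_filter]
      rw [h2] at h1
      linear_combination -h1
    have := toMulti_basis F fun k => u (i.succAbove k)
    rw [this, hs]
  · rw [← bracketSum_toMulti hF]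
    have hc : V.component 0 (toMulti n F) + V.component 1 (toMulti n F) = toMulti n F := by
      refine ext_basis fun u => ?_
      rw [_root_.add_apply, OspModule.component, OspModule.component, ofBasis_basis, ofBasis_basis]
      have h := sum_proj V (toMulti n F fun k => e (u k))
      rw [← Equiv.sum_comp (Equiv.addRight (∑ k, par (u k)))] at h
      exact (Fin.sum_univ_two _).symm.trans h
    refine (Fin.sum_univ_two _).trans ?_
    refine (bracketSum_add _ _ _ _).symm.trans ?_
    exact congrArg (fun f => bracketSum f _ _) hc

end

section

variable {M : Type*} [AddCommGroup M] [Module ℂ M]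

theorem ofFn_eq_append {n : ℕ} (u : Fin n → Gen) {i j : Fin n} (hij : (i : ℕ) + 1 = j) :
    List.ofFn u = (List.ofFn u).take i ++ u i :: u j :: (List.ofFn u).drop (i + 2) := by
  have hi : (i : ℕ) < (List.ofFn u).length := by simp
  have hj : (i : ℕ) + 1 < (List.ofFn u).length := by simp [hij]
  conv_lhs => rw [← List.take_append_drop i (List.ofFn u), List.drop_eq_getElem_cons hi,
    List.drop_eq_getElem_cons hj]
  simp [hij]
  omega

theorem exists_ofFn_swap {n : ℕ} (u : Fin n → Gen) {i j : Fin n} (hij : (i : ℕ) + 1 = j) :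
    ∃ p w : List Gen, p.length = i ∧ List.ofFn u = p ++ u i :: u j :: w ∧
      List.ofFn (fun k => u (Equiv.swap i j k)) = p ++ u j :: u i :: w := by
  refine ⟨(List.ofFn u).take i, (List.ofFn u).drop (i + 2), by simp [i.2.le], ofFn_eq_append u hij, ?_⟩
  rw [ofFn_eq_append (fun k => u (Equiv.swap i j k)) hij, Equiv.swap_apply_left,
    Equiv.swap_apply_right]
  congr 1
  · refine List.ext_getElem (by simp) fun k h1 h2 => ?_
    have hk : k < i := by
      rw [List.length_take] at h1
      omega
    simp only [List.getElem_take, List.getElem_ofFn]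
    rw [Equiv.swap_apply_of_ne_of_ne (by rw [Ne, Fin.ext_iff]; dsimp only; omega)
      (by rw [Ne, Fin.ext_iff]; dsimp only; omega)]
  · congr 2
    refine List.ext_getElem (by simp) fun k h1 h2 => ?_
    simp only [List.getElem_drop, List.getElem_ofFn]
    rw [Equiv.swap_apply_of_ne_of_ne (by rw [Ne, Fin.ext_iff]; dsimp only; omega)
      (by rw [Ne, Fin.ext_iff]; dsimp only; omega)]

theorem toMulti_mem {n : ℕ} {F : WordFun M} (hF : F ∈ anti M) : toMulti n F ∈ cochains M n := by
  intro q U hU i j hij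
  simp only [toMulti, ofBasis_apply]
  rw [← Equiv.sum_comp (Equiv.arrowCongr (Equiv.swap i j) (Equiv.refl Gen)), Finset.smul_sum,
    ← Finset.sum_neg_distrib]
  refine Finset.sum_congr rfl fun u _ => ?_
  have h1 : ∏ k, U (Equiv.swap i j k) (Equiv.arrowCongr (Equiv.swap i j) (Equiv.refl Gen) u k) =
      ∏ k, U k (u k) := by
    rw [← Equiv.prod_comp (Equiv.swap i j) fun k => U k (u k)]
    rfl
  have h2 : List.ofFn (Equiv.arrowCongr (Equiv.swap i j) (Equiv.refl Gen) u) =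
      List.ofFn fun k => u (Equiv.swap i j k) := rfl
  rw [h1, h2]
  by_cases h0 : ∏ k, U k (u k) = 0
  · rw [h0, zero_smul, zero_smul, smul_zero, neg_zero]
  · replace h0 := Finset.prod_ne_zero_iff.mp h0
    rw [← hU i _ (h0 i (Finset.mem_univ i)), ← hU j _ (h0 j (Finset.mem_univ j)), mul_comm]
    obtain ⟨p, w, -, hp1, hp2⟩ := exists_ofFn_swap u hij
    rw [hp1, hp2, hF, sg_smul, smul_neg]
    rw [smul_comm]

theorem toWord_mem {n : ℕ} {f : Multi M n} (hf : f ∈ cochains M n) : toWord n f ∈ anti M := by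
  intro p a b w
  by_cases hn : (p ++ a :: b :: w).length = n
  · subst hn
    set u := (p ++ a :: b :: w).get with hu
    have hlen : p.length + 1 < (p ++ a :: b :: w).length := by simp
    set i : Fin (p ++ a :: b :: w).length := ⟨p.length, by omega⟩ with hi
    set j : Fin (p ++ a :: b :: w).length := ⟨p.length + 1, hlen⟩ with hj
    have hij : (i : ℕ) + 1 = j := rfl
    obtain ⟨p', w', hp', h1, h2⟩ := exists_ofFn_swap u hij
    have h := hf (fun k => par (u k)) (fun k => e (u k)) (fun k => isHomog_e _) i j hij
    rw [← toWord_ofFn f u] at h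
    have h' := toWord_ofFn f fun k => u (Equiv.swap i j k)
    rw [h, h2, h1] at h'
    have h3 : p ++ a :: b :: w = p' ++ u i :: u j :: w' := by rw [← h1, hu, List.ofFn_get]
    obtain ⟨rfl, h4⟩ := List.append_inj h3 hp'.symm
    simp only [List.cons.injEq] at h4
    obtain ⟨ha, hb, rfl⟩ := h4
    rw [← ha, ← hb] at h'
    rw [h', sg_smul, smul_neg, smul_smul, sgn_mul_self, one_smul, neg_neg]
  · rw [toWord_of_length f hn, toWord_of_length f, smul_zero, neg_zero]
    simpa using hn

variable (V : OspModule M)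

theorem toWord_d {n : ℕ} {f : Multi M n} (hf : f ∈ cochains M n) :
    toWord (n + 1) (V.d n f) = dW (tw V) (toWord n f) := by
  ext w
  conv_lhs => rw [← toMulti_toWord f, d_toMulti V (toWord_mem hf)]
  by_cases hw : w.length = n + 1
  · rw [toWord_toMulti hw]
  · rw [toWord_of_length _ hw, dW_eq_zero_of_length]
    intro w' hw'
    exact toWord_of_length f (by omega)

theorem dW_toWord {n : ℕ} {f : Multi M n} (hf : f ∈ V.cocycles n) :
    dW (tw V) (toWord n f) = 0 := by
  rw [← toWord_d V hf.1, LinearMap.mem_ker.mp hf.2, map_zero]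

theorem toMulti_mem_cocycles {n : ℕ} {F : WordFun M} (hF : F ∈ anti M) (hd : dW (tw V) F = 0) :
    toMulti n F ∈ V.cocycles n := by
  refine ⟨toMulti_mem hF, ?_⟩
  rw [SetLike.mem_coe, LinearMap.mem_ker, d_toMulti V hF, hd]
  exact ext_basis fun u => by rw [toMulti_basis]; rfl

theorem mem_coboundaries {n : ℕ} {f : Multi M (n + 1)} {G : WordFun M} (hG : G ∈ anti M)
    (h : dW (tw V) G = toWord (n + 1) f) : f ∈ V.coboundaries (n + 1) :=
  ⟨toMulti n G, toMulti_mem hG, by rw [d_toMulti V hG, h, toMulti_toWord]⟩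

theorem tw_A_eq_zero_iff (v : M) : tw V .A v = 0 ↔ v ∈ V.kerA := by
  have h := parityOp_ρ V .A v
  rw [show sgn (par .A) = -1 from rfl, neg_smul, one_smul] at h
  rw [tw_of_odd V rfl, OspModule.kerA, LinearMap.mem_ker]
  constructor
  · intro h0
    rw [← parityOp_parityOp V (V.ρ (e .A) v), h, h0, neg_zero, map_zero]
  · intro h0
    rw [h0, map_zero, zero_eq_neg] at h
    exact h

theorem tw_B_eq_zero_iff (v : M) : tw V .B v = 0 ↔ v ∈ V.kerB := by
  have h := parityOp_ρ V .B v
  rw [show sgn (par .B) = -1 from rfl, neg_smul, one_smul] at h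
  rw [tw_of_odd V rfl, OspModule.kerB, LinearMap.mem_ker]
  constructor
  · intro h0
    rw [← parityOp_parityOp V (V.ρ (e .B) v), h, h0, neg_zero, map_zero]
  · intro h0
    rw [h0, map_zero, zero_eq_neg] at h
    exact h

theorem tw_H : tw V .H = V.ρ (e .H) := tw_of_even V rfl

theorem mem_kerAWeight_iff (α : ℂ) (v : M) :
    v ∈ V.kerAWeight α ↔ tw V .A v = 0 ∧ v ∈ (tw V .H).eigenspace α := by
  rw [tw_A_eq_zero_iff, tw_H]
  rfl

theorem parityOp_mem_kerAWeight {α : ℂ} {v : M} (hv : v ∈ V.kerAWeight α) :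
    parityOp V v ∈ V.kerAWeight α := by
  have h := parityOp_ρ V .H v
  rw [show sgn (par .H) = 1 from rfl, one_smul, Module.End.mem_eigenspace_iff.mp hv.2, map_smul] at h
  refine ⟨?_, Module.End.mem_eigenspace_iff.mpr h.symm⟩
  rw [SetLike.mem_coe, ← tw_A_eq_zero_iff, tw_of_odd V rfl, parityOp_parityOp]
  exact hv.1

/-- The twisted action of `B` has the same image on `(ker A)^α` as `B`. -/
theorem mem_map_B_iff (α : ℂ) (v : M) :
    v ∈ (V.kerAWeight α).map (V.ρ (e .B)) ↔ ∃ t ∈ V.kerAWeight α, tw V .B t = v := by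
  constructor
  · rintro ⟨t, ht, rfl⟩
    exact ⟨parityOp V t, parityOp_mem_kerAWeight V ht, by rw [tw_of_odd V rfl, parityOp_parityOp]⟩
  · rintro ⟨t, ht, rfl⟩
    exact ⟨parityOp V t, parityOp_mem_kerAWeight V ht, (tw_of_odd V rfl t).symm⟩

theorem surjective_tw_A (hA : Function.Surjective (V.ρ (e .A))) : Function.Surjective (tw V .A) := by
  intro v
  obtain ⟨u, rfl⟩ := hA v
  exact ⟨parityOp V u, by rw [tw_of_odd V rfl, parityOp_parityOp]⟩

end

section

variable {M : Type*} [AddCommGroup M] [Module ℂ M]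

/-! ### The class of a relative cocycle of degree one -/

section Class

variable {r : Gen → Module.End ℂ M} (hT : ⨆ μ, (r .H).eigenspace μ = ⊤) (σ : M →ₗ[ℂ] M)

/-- For `σ` a right inverse of `A`, this is the value on `B` of `F - ∂u`, where `u` is the vector of
weight zero with `A u = F(A)` provided by `σ`. It represents the class of a cocycle `F` of degree one
relative to `H`. -/
noncomputable def classVec : WordFun M →ₗ[ℂ] M :=
  (LinearMap.proj [Gen.B] : WordFun M →ₗ[ℂ] M) -
    r .B ∘ₗ wproj hT 0 ∘ₗ σ ∘ₗ (LinearMap.proj [Gen.A] : WordFun M →ₗ[ℂ] M)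

theorem classVec_apply (F : WordFun M) :
    classVec hT σ F = F [.B] - r .B (wproj hT 0 (σ (F [.A]))) := rfl

theorem r_A_wproj (hr : IsRep r) {σ : M →ₗ[ℂ] M} (hσ : ∀ v, r .A (σ v) = v) {v : M}
    (hv : v ∈ (r .H).eigenspace (1 / 2)) : r .A (wproj hT 0 (σ v)) = v := by
  rw [r_wproj hT hr, hσ, zero_add]
  exact wproj_eq hT hv

theorem r_H_wproj (v : M) : r .H (wproj hT 0 v) = 0 := by
  rw [Module.End.mem_eigenspace_iff.mp (wproj_mem hT 0 v), zero_smul]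

variable {F : WordFun M}

theorem value_A_mem (hL : lie r .H F = 0) : F [.A] ∈ (r .H).eigenspace (1 / 2) := by
  simpa [wtg] using (lie_H_eq_zero_iff F).mp hL [.A]

theorem value_B_mem (hL : lie r .H F = 0) : F [.B] ∈ (r .H).eigenspace (-1 / 2) := by
  simpa [wtg] using (lie_H_eq_zero_iff F).mp hL [.B]

theorem classVec_mem (hr : IsRep r) {σ : M →ₗ[ℂ] M} (hσ : ∀ v, r .A (σ v) = v) (hF : F ∈ anti M)
    (hH : ι .H F = 0) (hL : lie r .H F = 0) (hd : dW r F = 0) :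
    r .A (classVec hT σ F) = 0 ∧ classVec hT σ F ∈ (r .H).eigenspace (-1 / 2) := by
  rw [classVec_apply]
  constructor
  · have h := cf_dW (r := r) hF hH 1 1
    have hAB := r_A_r_B hr (wproj hT 0 (σ (F [.A])))
    rw [r_H_wproj, smul_zero, neg_zero, r_A_wproj hT hr hσ (value_A_mem hL)] at hAB
    have hA : cf F 1 0 = F [.A] := rfl
    have hB : cf F 0 1 = F [.B] := rfl
    simp [hd, cf_zero, hA, hB] at h
    rw [map_sub]
    linear_combination (norm := module) h - hAB
  · refine sub_mem (value_B_mem hL) ?_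
    have := r_mem_eigenspace hr .B (wproj_mem hT 0 (σ (F [.A])))
    rwa [wtg, zero_add] at this

/-- The class vanishes exactly when `F` agrees on `A` and `B` with the coboundary of a vector of weight
zero. -/
theorem classVec_eq_iff (hr : IsRep r) {σ : M →ₗ[ℂ] M} (hσ : ∀ v, r .A (σ v) = v)
    (hL : lie r .H F = 0) :
    (∃ t, (r .A t = 0 ∧ t ∈ (r .H).eigenspace 0) ∧ r .B t = classVec hT σ F) ↔
      ∃ u, r .H u = 0 ∧ F [.A] = r .A u ∧ F [.B] = r .B u := by
  rw [classVec_apply]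
  constructor
  · rintro ⟨t, ⟨htA, htH⟩, htB⟩
    rw [Module.End.mem_eigenspace_iff, zero_smul] at htH
    refine ⟨t + wproj hT 0 (σ (F [.A])), ?_, ?_, ?_⟩
    · rw [map_add, htH, r_H_wproj, add_zero]
    · rw [map_add, htA, zero_add, r_A_wproj hT hr hσ (value_A_mem hL)]
    · rw [map_add, htB, sub_add_cancel]
  · rintro ⟨u, huH, huA, huB⟩
    refine ⟨u - wproj hT 0 (σ (F [.A])), ⟨?_, ?_⟩, ?_⟩
    · rw [map_sub, r_A_wproj hT hr hσ (value_A_mem hL), huA, sub_self]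
    · rw [Module.End.mem_eigenspace_iff, zero_smul, map_sub, huH, r_H_wproj, sub_zero]
    · rw [map_sub, huB]

end Class

/-! ### Computation of the cohomology -/

theorem pr_eq_zero_of_length {r : Gen → Module.End ℂ M} (hT : ⨆ μ, (r .H).eigenspace μ = ⊤) {n : ℕ}
    (f : Multi M n) {w : List Gen} (h : w.length ≠ n) : pr hT (toWord n f) w = 0 := by
  rw [pr_apply, toWord_of_length f h, map_zero]

theorem pr_toMulti {r : Gen → Module.End ℂ M} (hT : ⨆ μ, (r .H).eigenspace μ = ⊤) {n : ℕ}
    {F : WordFun M} (hL : lie r .H F = 0) {w : List Gen} (h : w.length = n) :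
    pr hT (toWord n (toMulti n F)) w = F w := by
  rw [pr_apply, toWord_toMulti h, ← pr_apply, pr_eq hT hL]

variable (V : OspModule M)

theorem mem_coboundaries_of_pr (hT : ⨆ μ, (tw V .H).eigenspace μ = ⊤) {n : ℕ} {f : Multi M (n + 1)}
    (hf : f ∈ V.cocycles (n + 1)) {G : WordFun M} (hG : G ∈ anti M)
    (h : dW (tw V) G = pr hT (toWord (n + 1) f)) : f ∈ V.coboundaries (n + 1) := by
  refine mem_coboundaries V (add_mem hG (ι_mem (Φ_mem hT (fun x => x⁻¹) 0 (toWord_mem hf.1)) .H)) ?_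
  rw [map_add, h, ← sub_pr_eq hT (isRep_tw V) (dW_toWord V hf), add_sub_cancel]

theorem exists_pr_of_mem_coboundaries (hT : ⨆ μ, (tw V .H).eigenspace μ = ⊤) {n : ℕ}
    {f : Multi M (n + 1)} (hf : f ∈ V.coboundaries (n + 1)) :
    ∃ G ∈ anti M, lie (tw V) .H G = 0 ∧ dW (tw V) G = pr hT (toWord (n + 1) f) := by
  obtain ⟨g, hg, rfl⟩ := hf
  exact ⟨pr hT (toWord n g), pr_mem hT (toWord_mem hg), lie_H_pr hT _,
    by rw [dW_pr hT (isRep_tw V), toWord_d V hg]⟩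

/-- The isomorphism from the cohomology given by a surjection from the cocycles whose kernel consists
of the coboundaries. -/
noncomputable def cohomologyEquiv {n : ℕ} {N : Type*} [AddCommGroup N] [Module ℂ N]
    (φ : V.cocycles n →ₗ[ℂ] N) (hs : Function.Surjective φ)
    (hk : ∀ z, φ z = 0 ↔ (z : Multi M n) ∈ V.coboundaries n) : V.Cohomology n ≃ₗ[ℂ] N :=
  (Submodule.quotEquivOfEq _ _ (by
    ext z
    exact (hk z).symm)).trans (φ.quotKerEquivOfSurjective hs)

theorem cohomologyEquiv_mk {n : ℕ} {N : Type*} [AddCommGroup N] [Module ℂ N]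
    (φ : V.cocycles n →ₗ[ℂ] N) (hs : Function.Surjective φ)
    (hk : ∀ z, φ z = 0 ↔ (z : Multi M n) ∈ V.coboundaries n) (z : V.cocycles n) :
    cohomologyEquiv V φ hs hk (V.cohomologyClass n z) = φ z := rfl

theorem cohomology_zero : ∃ φ : V.Cohomology 0 ≃ₗ[ℂ] ↥(V.kerA ⊓ V.kerB),
    ∀ z : V.cocycles 0, (φ (V.cohomologyClass 0 z) : M) = (z : Multi M 0) ![] := by
  have hev (f : Multi M 0) : toWord 0 f [] = f ![] := by
    rw [← List.ofFn_zero (f := fun k : Fin 0 => k.elim0), toWord_ofFn]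
    congr 1
    exact Subsingleton.elim _ _
  let φ₀ : V.cocycles 0 →ₗ[ℂ] M := LinearMap.proj [] ∘ₗ toWord 0 ∘ₗ (V.cocycles 0).subtype
  have hφ₀ (z : V.cocycles 0) : φ₀ z = toWord 0 (z : Multi M 0) [] := rfl
  let φ : V.cocycles 0 →ₗ[ℂ] ↥(V.kerA ⊓ V.kerB) := φ₀.codRestrict _ fun z => by
    have h (a : Gen) : tw V a (φ₀ z) = 0 := by
      rw [hφ₀, ← dW_singleton, dW_toWord V z.2, Pi.zero_apply]
    exact ⟨(tw_A_eq_zero_iff V _).mp (h .A), (tw_B_eq_zero_iff V _).mp (h .B)⟩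
  refine ⟨cohomologyEquiv V φ ?_ ?_, fun z => ?_⟩
  · rintro ⟨v, hvA, hvB⟩
    have hv := r_eq_zero (isRep_tw V) ((tw_A_eq_zero_iff V v).mpr hvA) ((tw_B_eq_zero_iff V v).mpr hvB)
    exact ⟨⟨toMulti 0 (deg₀ v), toMulti_mem_cocycles V (deg₀_mem v) (dW_deg₀ hv)⟩,
      Subtype.ext (toWord_toMulti (n := 0) (F := deg₀ v) (w := []) rfl)⟩
  · intro z
    rw [Subtype.ext_iff]
    change toWord 0 (z : Multi M 0) [] = 0 ↔ (z : Multi M 0) ∈ (⊥ : Submodule ℂ (Multi M 0))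
    rw [Submodule.mem_bot, hev]
    constructor
    · intro h
      refine MultilinearMap.ext fun U => ?_
      rw [Subsingleton.elim U ![], h]
      rfl
    · intro h
      rw [h]
      rfl
  · exact (congrArg Subtype.val (cohomologyEquiv_mk V φ _ _ z)).trans (hev _)

variable {V}

theorem contraction_relative {F : WordFun M} (hF : F ∈ anti M)
    (hL : lie (tw V) .H F = 0) (hd : dW (tw V) F = 0) :
    ι .H F ∈ anti M ∧ ι .H (ι .H F) = 0 ∧ lie (tw V) .H (ι .H F) = 0 ∧ dW (tw V) (ι .H F) = 0 := by
  refine ⟨ι_mem hF .H, ι_ι_self hF rfl, by rw [lie_ι_H, hL, map_zero], ?_⟩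
  have := ι_dW (r := tw V) .H F
  rw [hd, hL, map_zero, zero_sub, zero_eq_neg] at this
  exact this

theorem cocycle_pr (hT : ⨆ μ, (tw V .H).eigenspace μ = ⊤) {n : ℕ} {f : Multi M n}
    (hf : f ∈ V.cocycles n) : pr hT (toWord n f) ∈ anti M ∧
      lie (tw V) .H (pr hT (toWord n f)) = 0 ∧ dW (tw V) (pr hT (toWord n f)) = 0 :=
  ⟨pr_mem hT (toWord_mem hf.1), lie_H_pr hT _,
    by rw [dW_pr hT (isRep_tw V), dW_toWord V hf, map_zero]⟩

theorem exists_rightInverse (hA : Function.Surjective (tw V .A)) :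
    ∃ σ : M →ₗ[ℂ] M, ∀ v, tw V .A (σ v) = v := by
  obtain ⟨σ, hσ⟩ := (tw V .A).exists_rightInverse_of_surjective (LinearMap.range_eq_top.mpr hA)
  exact ⟨σ, LinearMap.congr_fun hσ⟩

theorem mk_eq_zero_iff {v : M} (hv : v ∈ V.kerAWeight (-1 / 2)) :
    (Submodule.Quotient.mk ⟨v, hv⟩ : V.KerQuotient) = 0 ↔
      ∃ t, (tw V .A t = 0 ∧ t ∈ (tw V .H).eigenspace 0) ∧ tw V .B t = v := by
  rw [Submodule.Quotient.mk_eq_zero]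
  refine (mem_map_B_iff V _ _).trans ?_
  simp only [mem_kerAWeight_iff]
  rfl

theorem cohomology_two (hT : ⨆ μ, (tw V .H).eigenspace μ = ⊤) (hA : Function.Surjective (tw V .A)) :
    Nonempty (V.Cohomology 2 ≃ₗ[ℂ] V.KerQuotient) := by
  obtain ⟨σ, hσ⟩ := exists_rightInverse hA
  have hr := isRep_tw V
  let φ₀ : V.cocycles 2 →ₗ[ℂ] M :=
    classVec hT σ ∘ₗ ι .H ∘ₗ pr hT ∘ₗ toWord 2 ∘ₗ (V.cocycles 2).subtype
  have hφ₀ (z : V.cocycles 2) : φ₀ z = classVec hT σ (ι .H (pr hT (toWord 2 (z : Multi M 2)))) := rfl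
  have hmem (z : V.cocycles 2) : φ₀ z ∈ V.kerAWeight (-1 / 2) := by
    obtain ⟨h1, h2, h3⟩ := cocycle_pr hT z.2
    obtain ⟨h4, h5, h6, h7⟩ := contraction_relative h1 h2 h3
    rw [mem_kerAWeight_iff, hφ₀]
    exact classVec_mem hT hr hσ h4 h5 h6 h7
  let φ : V.cocycles 2 →ₗ[ℂ] V.KerQuotient := Submodule.mkQ _ ∘ₗ φ₀.codRestrict _ hmem
  refine ⟨cohomologyEquiv V φ ?_ ?_⟩
  · intro x
    obtain ⟨⟨v, hv⟩, rfl⟩ := Submodule.Quotient.mk_surjective _ x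
    obtain ⟨hvA, hvH⟩ := (mem_kerAWeight_iff V _ v).mp hv
    obtain ⟨F, hF, hFH, hFL, hFd, hFA, hFB⟩ := exists_relative_one hT hr hvA hvH
    obtain ⟨G, hG, hGL, hGd, hGF⟩ := exists_contraction_eq hT hr hA hF hFH hFL hFd
    refine ⟨⟨toMulti 2 G, toMulti_mem_cocycles V hG hGd⟩, ?_⟩
    change Submodule.Quotient.mk _ = _
    congr 1
    refine Subtype.ext ?_
    change classVec hT σ (ι .H (pr hT (toWord 2 (toMulti 2 G)))) = v
    rw [classVec_apply, ι_apply, ι_apply, pr_toMulti hT (n := 2) hGL (w := [.H, .B]) rfl,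
      pr_toMulti hT (n := 2) hGL (w := [.H, .A]) rfl, ← ι_apply .H G, ← ι_apply .H G, hGF, hFA, hFB,
      map_zero, map_zero, map_zero, sub_zero]
  · intro z
    obtain ⟨h1, h2, h3⟩ := cocycle_pr hT z.2
    obtain ⟨h4, h5, h6, h7⟩ := contraction_relative h1 h2 h3
    refine (mk_eq_zero_iff (hmem z)).trans ?_
    rw [hφ₀, classVec_eq_iff hT hr hσ h6]
    constructor
    · rintro ⟨u, hu, huA, huB⟩
      obtain ⟨G, hG, hGd⟩ := exact_of_contraction hT hr hA h1 h2 h3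
        (pr_eq_zero_of_length hT _ (by simp)) (fun a => pr_eq_zero_of_length hT _ (by simp)) hu huA huB
      exact mem_coboundaries_of_pr V hT z.2 hG hGd
    · intro hz
      obtain ⟨G, hG, hGL, hGd⟩ := exists_pr_of_mem_coboundaries V hT hz
      rw [← hGd, ι_dW, hGL, zero_sub]
      have hw := (lie_H_eq_zero_iff G).mp hGL [.H]
      refine ⟨-G [.H], ?_, ?_, ?_⟩
      · simpa [wtg] using hw
      · rw [Pi.neg_apply, dW_singleton, map_neg, ι_apply]
      · rw [Pi.neg_apply, dW_singleton, map_neg, ι_apply]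

theorem cohomology_of_two_lt (hT : ⨆ μ, (tw V .H).eigenspace μ = ⊤)
    (hA : Function.Surjective (tw V .A)) {n : ℕ} (hn : 2 < n) : Subsingleton (V.Cohomology n) := by
  obtain ⟨m, rfl⟩ : ∃ m, n = m + 3 := ⟨n - 3, by omega⟩
  refine Submodule.Quotient.subsingleton_iff.mpr (eq_top_iff.mpr fun z _ => ?_)
  change (z : Multi M (m + 3)) ∈ V.coboundaries (m + 3)
  obtain ⟨h1, h2, h3⟩ := cocycle_pr hT z.2
  have h0 {w : List Gen} (hw : w.length ≤ 2) : pr hT (toWord (m + 3) (z : Multi M (m + 3))) w = 0 :=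
    pr_eq_zero_of_length hT _ (by omega)
  obtain ⟨G, hG, hGd⟩ := exact_of_contraction hT (isRep_tw V) hA h1 h2 h3 (h0 (by simp))
    (fun a => h0 (by simp)) (map_zero _) (by rw [h0 (by simp), map_zero])
    (by rw [h0 (by simp), map_zero])
  exact mem_coboundaries_of_pr V hT z.2 hG hGd

theorem cohomology_one (hT : ⨆ μ, (tw V .H).eigenspace μ = ⊤) (hA : Function.Surjective (tw V .A)) :
    Nonempty (V.Cohomology 1 ≃ₗ[ℂ] ↥(V.kerA ⊓ V.kerB) × V.KerQuotient) := by
  obtain ⟨σ, hσ⟩ := exists_rightInverse hA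
  have hr := isRep_tw V
  let π₀ : V.cocycles 1 →ₗ[ℂ] M :=
    LinearMap.proj [.H] ∘ₗ pr hT ∘ₗ toWord 1 ∘ₗ (V.cocycles 1).subtype
  have hπ₀ (z : V.cocycles 1) : π₀ z = pr hT (toWord 1 (z : Multi M 1)) [.H] := rfl
  let π : V.cocycles 1 →ₗ[ℂ] ↥(V.kerA ⊓ V.kerB) := π₀.codRestrict _ fun z => by
    obtain ⟨h1, h2, h3⟩ := cocycle_pr hT z.2
    obtain ⟨-, -, -, h7⟩ := contraction_relative h1 h2 h3
    have h (a : Gen) : tw V a (π₀ z) = 0 := by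
      exact (dW_singleton a _).symm.trans (congrFun h7 [a])
    exact ⟨(tw_A_eq_zero_iff V _).mp (h .A), (tw_B_eq_zero_iff V _).mp (h .B)⟩
  have hπ : Function.Surjective π := by
    rintro ⟨v, hvA, hvB⟩
    have hv := r_eq_zero hr ((tw_A_eq_zero_iff V v).mpr hvA) ((tw_B_eq_zero_iff V v).mpr hvB)
    obtain ⟨G, hG, hGL, hGd, hGF⟩ := exists_contraction_eq hT hr hA (deg₀_mem v) (ι_deg₀ _ _)
      (lie_deg₀ (hv .H)) (dW_deg₀ hv)
    refine ⟨⟨toMulti 1 G, toMulti_mem_cocycles V hG hGd⟩, Subtype.ext ?_⟩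
    change pr hT (toWord 1 (toMulti 1 G)) [.H] = v
    rw [pr_toMulti hT (n := 1) hGL (w := [.H]) rfl]
    exact congrFun hGF []
  have hrel (z : V.cocycles 1) (hz : π z = 0) : ι .H (pr hT (toWord 1 (z : Multi M 1))) = 0 := by
    ext w
    rcases w with _ | ⟨a, w⟩
    · exact congrArg Subtype.val hz
    · exact pr_eq_zero_of_length hT _ (by simp)
  obtain ⟨s, hs⟩ := π.exists_rightInverse_of_surjective (LinearMap.range_eq_top.mpr hπ)
  have hs' (v) : π (s v) = v := LinearMap.congr_fun hs v
  -- The section `s` splits off the contraction with `H`: `τ z` is a cocycle relative to `H`, up to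
  -- its components of nonzero weight.
  let τ : V.cocycles 1 →ₗ[ℂ] V.cocycles 1 := LinearMap.id - s ∘ₗ π
  have hτ (z) : τ z = z - s (π z) := rfl
  have hπτ (z) : π (τ z) = 0 := by rw [hτ, map_sub, hs', sub_self]
  let φ₀ : V.cocycles 1 →ₗ[ℂ] M :=
    classVec hT σ ∘ₗ pr hT ∘ₗ toWord 1 ∘ₗ (V.cocycles 1).subtype ∘ₗ τ
  have hφ₀ (z : V.cocycles 1) : φ₀ z = classVec hT σ (pr hT (toWord 1 (τ z : Multi M 1))) := rfl
  have hmem (z : V.cocycles 1) : φ₀ z ∈ V.kerAWeight (-1 / 2) := by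
    obtain ⟨h1, h2, h3⟩ := cocycle_pr hT (τ z).2
    rw [mem_kerAWeight_iff, hφ₀]
    exact classVec_mem hT hr hσ h1 (hrel _ (hπτ z)) h2 h3
  let φ : V.cocycles 1 →ₗ[ℂ] ↥(V.kerA ⊓ V.kerB) × V.KerQuotient :=
    π.prod (Submodule.mkQ _ ∘ₗ φ₀.codRestrict _ hmem)
  refine ⟨cohomologyEquiv V φ ?_ ?_⟩
  · rintro ⟨ρ, x⟩
    obtain ⟨⟨v, hv⟩, rfl⟩ := Submodule.Quotient.mk_surjective _ x
    obtain ⟨hvA, hvH⟩ := (mem_kerAWeight_iff V _ v).mp hv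
    obtain ⟨F, hF, hFH, hFL, hFd, hFA, hFB⟩ := exists_relative_one hT hr hvA hvH
    set z₁ : V.cocycles 1 := ⟨toMulti 1 F, toMulti_mem_cocycles V hF hFd⟩ with hz₁
    have hπ₁ : π z₁ = 0 := by
      refine Subtype.ext ?_
      change pr hT (toWord 1 (toMulti 1 F)) [.H] = 0
      rw [pr_toMulti hT (n := 1) hFL (w := [.H]) rfl]
      exact congrFun hFH []
    have hπz : π (z₁ + s ρ) = ρ := by rw [map_add, hπ₁, hs', zero_add]
    have hτz : τ (z₁ + s ρ) = z₁ := by rw [hτ, hπz, add_sub_cancel_right]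
    refine ⟨z₁ + s ρ, Prod.ext hπz ?_⟩
    change Submodule.Quotient.mk _ = Submodule.Quotient.mk _
    congr 1
    refine Subtype.ext ?_
    change φ₀ (z₁ + s ρ) = v
    rw [hφ₀, hτz, classVec_apply]
    change pr hT (toWord 1 (toMulti 1 F)) [.B] -
      tw V .B (wproj hT 0 (σ (pr hT (toWord 1 (toMulti 1 F)) [.A]))) = v
    rw [pr_toMulti hT (n := 1) hFL (w := [.B]) rfl, pr_toMulti hT (n := 1) hFL (w := [.A]) rfl,
      hFA, hFB, map_zero, map_zero, map_zero, sub_zero]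
  · intro z
    obtain ⟨h1, h2, h3⟩ := cocycle_pr hT z.2
    have hφz : φ z = 0 ↔ π z = 0 ∧
        ∃ u, tw V .H u = 0 ∧ pr hT (toWord 1 (z : Multi M 1)) [.A] = tw V .A u ∧
          pr hT (toWord 1 (z : Multi M 1)) [.B] = tw V .B u := by
      refine Prod.ext_iff.trans (and_congr_right fun hz => ?_)
      have hz' : π z = 0 := hz
      have hτz : τ z = z := by rw [hτ, hz', map_zero, sub_zero]
      refine (mk_eq_zero_iff (hmem z)).trans ?_
      rw [hφ₀, hτz, classVec_eq_iff hT hr hσ h2]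
    rw [hφz]
    constructor
    · rintro ⟨hz, u, hu, huA, huB⟩
      obtain ⟨G, hG, -, -, hGd⟩ := exact_relative hT hr hA h1 (hrel z hz) h2 h3
        (pr_eq_zero_of_length hT _ (by simp)) hu huA huB
      exact mem_coboundaries_of_pr V hT z.2 hG hGd
    · intro hz
      obtain ⟨G, hG, hGL, hGd⟩ := exists_pr_of_mem_coboundaries V hT hz
      have hw : tw V .H (G []) = 0 := by simpa using (lie_H_eq_zero_iff G).mp hGL []
      refine ⟨Subtype.ext ?_, G [], hw, ?_, ?_⟩
      · change pr hT (toWord 1 (z : Multi M 1)) [.H] = 0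
        rw [← hGd, dW_singleton, hw]
      · rw [← hGd, dW_singleton]
      · rw [← hGd, dW_singleton]

end

end Osp12

theorem theorem1 {M : Type*} [AddCommGroup M] [Module ℂ M] (V : Osp12.OspModule M)
    (hweight : V.IsWeight) (hA : Function.Surjective (V.ρ (Osp12.e .A))) :
    (∃ φ : V.Cohomology 0 ≃ₗ[ℂ] ↥(V.kerA ⊓ V.kerB),
      ∀ z : V.cocycles 0, (φ (V.cohomologyClass 0 z) : M) = (z : Osp12.Multi M 0) ![]) ∧
    Nonempty (V.Cohomology 1 ≃ₗ[ℂ] ↥(V.kerA ⊓ V.kerB) × V.KerQuotient) ∧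
    Nonempty (V.Cohomology 2 ≃ₗ[ℂ] V.KerQuotient) ∧
    ∀ n : ℕ, 2 < n → Subsingleton (V.Cohomology n) := by
  have hT : ⨆ μ, (Osp12.tw V .H).eigenspace μ = ⊤ := by
    rw [Osp12.tw_H]
    exact hweight
  have hA' := Osp12.surjective_tw_A V hA
  exact ⟨Osp12.cohomology_zero V, Osp12.cohomology_one hT hA', Osp12.cohomology_two hT hA',
    fun n hn => Osp12.cohomology_of_two_lt hT hA' hn⟩
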